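/- Let $\mathbb{T}=\mathbb{R}/2\pi\mathbb{Z}$, with inner products taken with respect to $\frac{dx}{2\pi}$, and let $M,N,d\ge 1$ be integers. For $U=\sum_{n\in\mathbb{Z}}\hat U(n)e^{inx}\in L^2(\mathbb{T};\mathbb{C}^{M\times N})$ put $\Pi_{\ge 0}U=\sum_{n\ge 0}\hat U(n)e^{inx}$ and $L^2_+=\Pi_{\ge0}(L^2)$. Put $\|U\|_{H^s}^2=\sum_{k,j}\sum_{n}(1+n^2)^s|\hat U_{kj}(n)|^2$, $H^s_+=\Pi_{\ge 0}(H^s)$, and $\|U\|_{L^\infty}^2=\sum_{k,j}\|U_{kj}\|_{L^\infty}^2$. For a bounded symbol $U\in L^2_+(\mathbb{T};\mathbb{C}^{M\times N})$ the right and left Hankel operators are $$\mathbf{H}^{(r)}_U:F\in L^2_+(\mathbb{T};\mathbb{C}^{d\times N})\mapsto \Pi_{\ge 0}(UF^*)\in L^2_+(\mathbb{T};\mathbb{C}^{M\times d}),\qquad \mathbf{H}^{(l)}_U:G\in L^2_+(\mathbb{T};\mathbb{C}^{M\times d})\mapsto \Pi_{\ge 0}(G^*U)\in L^2_+(\mathbb{T};\mathbb{C}^{d\times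 N}),$$ so that $\mathbf{H}^{(r)}_U\mathbf{H}^{(l)}_U$ acts on $L^2_+(\mathbb{T};\mathbb{C}^{M\times d})$. Let $s>1$. There is a constant $C_s>0$ (depending only on $s$ and on the fixed dimensions $M,N,d$) such that for every solution $U\in C^\infty(\mathbb{R};H^s_+(\mathbb{T};\mathbb{C}^{M\times N}))$ of the matrix Szegő equation $i\partial_tU=\Pi_{\ge 0}(UU^*U)$, the operator $\mathbf{H}^{(r)}_{U(0)}\mathbf{H}^{(l)}_{U(0)}$ has a positive bounded square root, this square root is of trace class, and $$\sup_{\tau\in\mathbb{R}}\|U(\tau)\|_{L^\infty}\le 2\,\mathrm{Tr}\sqrt{\mathbf{H}^{(r)}_{U(0)}\mathbf{H}^{(l)}_{U(0)}}\le C_s\|U(t)\|_{H^s}\qquad\text{for all } t\in\mathbb{R},$$ and moreover $$\|U(t)\|_{H^s}\le C_s\,e^{C_s|t|\,\|U(0)\|_{H^s}^2}\,\|U(0)\|_{H^s}\qquad\text{for all } t\in\mathbb{R}.$$ -/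

import Mathlib

open MeasureTheory AddCircle Complex
open scoped ENNReal ContDiff InnerProductSpace Matrix

namespace MatrixSzego

noncomputable section

instance factTwoPiPos : Fact (0 < 2 * Real.pi) := ⟨Real.two_pi_pos⟩

/-- The torus `ℝ / 2πℤ`; its measure below is always `haarAddCircle`, i.e. `dx / (2π)`. -/
abbrev Torus : Type := AddCircle (2 * Real.pi)

/-- `L²(𝕋; ℂ)`. -/
abbrev ScalarL2 : Type := Lp ℂ 2 (haarAddCircle (T := 2 * Real.pi))

/-- `L²(𝕋; ℂ^{M×N})`: matrices of scalar `L²` functions, with the Hilbert space structure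
`⟨U, V⟩ = ∑_{k,j} ⟨U_{kj}, V_{kj}⟩`. -/
abbrev L2 (M N : ℕ) : Type := PiLp 2 (fun _ : Fin M × Fin N => ScalarL2)

/-- The `n`-th Fourier coefficient `Û(n)`, a matrix. -/
def coeff {M N : ℕ} (U : L2 M N) (n : ℤ) : Matrix (Fin M) (Fin N) ℂ :=
  fun k j => fourierCoeff (U (k, j) : Torus → ℂ) n

/-- The value `U(x)`, a matrix (defined for almost every `x`). -/
def eval {M N : ℕ} (U : L2 M N) (x : Torus) : Matrix (Fin M) (Fin N) ℂ :=
  fun k j => (U (k, j) : Torus → ℂ) x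

open Classical in
/-- The class in `L²(𝕋; ℂ^{M×N})` of a square integrable matrix function
(an entry that is not square integrable is replaced by `0`). -/
def ofFun {M N : ℕ} (f : Torus → Matrix (Fin M) (Fin N) ℂ) : L2 M N :=
  WithLp.toLp 2 fun p =>
    if h : MemLp (fun x => f x p.1 p.2) 2 (haarAddCircle (T := 2 * Real.pi)) then h.toLp else 0

theorem coeff_apply_eq_repr {M N : ℕ} (U : L2 M N) (n : ℤ) (k : Fin M) (j : Fin N) :
    coeff U n k j = fourierBasis.repr (U (k, j)) n :=
  (fourierBasis_repr _ _).symm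

theorem coeff_add {M N : ℕ} (U V : L2 M N) (n : ℤ) : coeff (U + V) n = coeff U n + coeff V n := by
  ext k j
  simp [coeff_apply_eq_repr]

theorem coeff_smul {M N : ℕ} (c : ℂ) (U : L2 M N) (n : ℤ) : coeff (c • U) n = c • coeff U n := by
  ext k j
  simp [coeff_apply_eq_repr]

theorem coeff_zero {M N : ℕ} (n : ℤ) : coeff (0 : L2 M N) n = 0 := by
  ext k j
  simp [coeff_apply_eq_repr]

/-- A function in `L²` is determined by its Fourier coefficients. -/
theorem ext_coeff {M N : ℕ} {U V : L2 M N} (h : ∀ n, coeff U n = coeff V n) : U = V := by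
  ext1 ⟨k, j⟩
  apply fourierBasis.repr.injective
  ext n
  rw [← coeff_apply_eq_repr, ← coeff_apply_eq_repr, h n]

/-! ### The Szegő projector -/

/-- `L²₊(𝕋; ℂ^{M×N})`: the elements of `L²` without negative Fourier modes. -/
def L2plus (M N : ℕ) : Submodule ℂ (L2 M N) where
  carrier := {U | ∀ n : ℤ, n < 0 → coeff U n = 0}
  add_mem' {U V} hU hV n hn := by rw [coeff_add, hU n hn, hV n hn, add_zero]
  zero_mem' n _ := coeff_zero n
  smul_mem' c U hU n hn := by rw [coeff_smul, hU n hn, smul_zero]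

theorem isClosed_L2plus (M N : ℕ) : IsClosed (L2plus M N : Set (L2 M N)) := by
  have h : (L2plus M N : Set (L2 M N)) =
      ⋂ (n : ℤ) (_ : n < 0) (k : Fin M) (j : Fin N),
        {U : L2 M N | ⟪fourierBasis (T := 2 * Real.pi) n, U (k, j)⟫_ℂ = 0} := by
    ext U
    simp only [Set.mem_iInter, Set.mem_ofPred_eq, SetLike.mem_coe]
    constructor
    · intro hU n hn k j
      have := congrFun (congrFun (hU n hn) k) j
      rwa [coeff_apply_eq_repr, HilbertBasis.repr_apply_apply] at this
    · intro hU n hn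
      ext k j
      rw [coeff_apply_eq_repr, HilbertBasis.repr_apply_apply]
      exact hU n hn k j
  rw [h]
  refine isClosed_iInter fun n => isClosed_iInter fun _ => isClosed_iInter fun k =>
    isClosed_iInter fun j => isClosed_eq ?_ continuous_const
  exact continuous_const.inner (PiLp.continuous_apply 2 _ (k, j))

instance (M N : ℕ) : CompleteSpace (L2plus M N) :=
  (isClosed_L2plus M N).completeSpace_coe

/-- The scalar Szegő projector `f ↦ ∑_{n ≥ 0} f̂(n) e^{inx}` (the series converges in `L²`). -/
def scalarSzego (f : ScalarL2) : ScalarL2 :=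
  ∑' n : ℕ, fourierCoeff (f : Torus → ℂ) n • fourierLp 2 (n : ℤ)

theorem hasSum_scalarSzego (f : ScalarL2) :
    HasSum (fun n : ℕ => fourierCoeff (f : Torus → ℂ) n • fourierLp 2 (n : ℤ)) (scalarSzego f) :=
  ((hasSum_fourier_series_L2 f).summable.comp_injective
    (i := fun n : ℕ => (n : ℤ)) Nat.cast_injective).hasSum

theorem fourierCoeff_scalarSzego (f : ScalarL2) (m : ℤ) :
    fourierCoeff (scalarSzego f : Torus → ℂ) m =
      if 0 ≤ m then fourierCoeff (f : Torus → ℂ) m else 0 := by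
  rw [← fourierBasis_repr, HilbertBasis.repr_apply_apply]
  have h := (hasSum_scalarSzego f).mapL (innerSL ℂ (fourierBasis (T := 2 * Real.pi) m))
  have h2 : ∀ n : ℕ, innerSL ℂ (fourierBasis (T := 2 * Real.pi) m)
      (fourierCoeff (f : Torus → ℂ) n • fourierLp 2 (n : ℤ)) =
      if m = (n : ℤ) then fourierCoeff (f : Torus → ℂ) n else 0 := by
    intro n
    rw [innerSL_apply_apply, inner_smul_right, coe_fourierBasis,
      orthonormal_iff_ite.mp orthonormal_fourier]
    split_ifs <;> simp
  simp only [h2] at h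
  rw [innerSL_apply_apply] at h
  rw [← h.tsum_eq]
  split_ifs with hm
  · lift m to ℕ using hm
    rw [tsum_eq_single m]
    · simp
    · intro b hb
      rw [if_neg]
      exact fun h => hb (by exact_mod_cast h.symm)
  · rw [tsum_congr (g := fun _ => (0 : ℂ)), tsum_zero]
    intro n
    rw [if_neg]
    omega

/-- The Szegő projector `Π_{≥0} : L²(𝕋; ℂ^{M×N}) → L²₊(𝕋; ℂ^{M×N})`, acting on each entry. -/
def szego {M N : ℕ} (U : L2 M N) : L2plus M N :=
  ⟨WithLp.toLp 2 fun p => scalarSzego (U p), fun n hn => by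
    ext k j
    simp only [coeff, fourierCoeff_scalarSzego, Matrix.zero_apply]
    rw [if_neg (by omega)]⟩

theorem coeff_szego {M N : ℕ} (U : L2 M N) (n : ℤ) :
    coeff (szego U : L2 M N) n = if 0 ≤ n then coeff U n else 0 := by
  ext k j
  simp only [coeff, szego, fourierCoeff_scalarSzego]
  split_ifs <;> rfl

/-! ### Sobolev spaces -/

/-- The weight `(1 + n²)^{s/2}`. -/
def weight (s : ℝ) (n : ℤ) : ℝ := (1 + (n : ℝ) ^ 2) ^ (s / 2)

theorem weight_pos (s : ℝ) (n : ℤ) : 0 < weight s n := Real.rpow_pos_of_pos (by positivity) _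

/-- The weighted Fourier coefficients `(1 + n²)^{s/2} Û_{kj}(n)` of an entry. -/
def weightedCoeff {M N : ℕ} (s : ℝ) (U : L2 M N) (p : Fin M × Fin N) : ℤ → ℂ :=
  fun n => (weight s n : ℂ) * coeff U n p.1 p.2

/-- `H^s₊(𝕋; ℂ^{M×N})` as a set of functions: `∑_n (1 + n²)^s |Û_{kj}(n)|² < ∞` for each entry,
and no negative Fourier modes. -/
def sobolevPlusSubmodule (s : ℝ) (M N : ℕ) : Submodule ℂ (L2 M N) where
  carrier := {U | U ∈ L2plus M N ∧ ∀ p, Memℓp (weightedCoeff s U p) 2}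
  add_mem' {U V} hU hV := by
    refine ⟨add_mem hU.1 hV.1, fun p => ?_⟩
    have : weightedCoeff s (U + V) p = weightedCoeff s U p + weightedCoeff s V p := by
      ext n
      simp [weightedCoeff, coeff_add, mul_add]
    rw [this]
    exact (hU.2 p).add (hV.2 p)
  zero_mem' := by
    refine ⟨zero_mem _, fun p => ?_⟩
    have : weightedCoeff s (0 : L2 M N) p = 0 := by
      ext n
      simp [weightedCoeff, coeff_zero]
    rw [this]
    exact zero_memℓp
  smul_mem' c U hU := by
    refine ⟨(L2plus M N).smul_mem c hU.1, fun p => ?_⟩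
    have : weightedCoeff s (c • U) p = c • weightedCoeff s U p := by
      ext n
      simp [weightedCoeff, coeff_smul]
      ring
    rw [this]
    exact (hU.2 p).const_smul c

/-- The space `H^s₊(𝕋; ℂ^{M×N})`, which will carry its own norm
`‖U‖²_{H^s} = ∑_{k,j} ∑_n (1 + n²)^s |Û_{kj}(n)|²` (not the `L²` norm). -/
def SobolevPlus (s : ℝ) (M N : ℕ) : Type := sobolevPlusSubmodule s M N

namespace SobolevPlus

variable {s : ℝ} {M N : ℕ}

instance : AddCommGroup (SobolevPlus s M N) :=
  inferInstanceAs (AddCommGroup (sobolevPlusSubmodule s M N))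

instance : Module ℂ (SobolevPlus s M N) :=
  inferInstanceAs (Module ℂ (sobolevPlusSubmodule s M N))

/-- The inclusion `H^s₊ ⊂ L²`. -/
def toL2 : SobolevPlus s M N →ₗ[ℂ] L2 M N := (sobolevPlusSubmodule s M N).subtype

/-- `U ↦ ((1 + n²)^{s/2} Û_{kj}(n))_{k,j,n}`, which defines the `H^s` norm. -/
def weightMap :
    SobolevPlus s M N →ₗ[ℂ] PiLp 2 (fun _ : Fin M × Fin N => lp (fun _ : ℤ => ℂ) 2) where
  toFun U := WithLp.toLp 2 fun p => ⟨weightedCoeff s (toL2 U) p, U.2.2 p⟩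
  map_add' U V := by
    ext p n
    have h : weightedCoeff s (toL2 (U + V)) p n =
        weightedCoeff s (toL2 U) p n + weightedCoeff s (toL2 V) p n := by
      simp [weightedCoeff, coeff_add, mul_add]
    exact h
  map_smul' c U := by
    ext p n
    simp [weightedCoeff, coeff_smul]
    ring

theorem weightMap_apply (U : SobolevPlus s M N) (p : Fin M × Fin N) (n : ℤ) :
    weightMap U p n = (weight s n : ℂ) * coeff (toL2 U) n p.1 p.2 := rfl

theorem weightMap_injective : Function.Injective (weightMap (s := s) (M := M) (N := N)) := by
  intro U V h
  apply Subtype.ext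
  apply ext_coeff
  intro n
  ext k j
  have h1 : weightMap U (k, j) n = weightMap V (k, j) n := by rw [h]
  rw [weightMap_apply, weightMap_apply] at h1
  exact mul_left_cancel₀ (by exact_mod_cast (weight_pos s n).ne') h1

instance : NormedAddCommGroup (SobolevPlus s M N) :=
  NormedAddCommGroup.induced _ _ weightMap weightMap_injective

instance : NormedSpace ℂ (SobolevPlus s M N) :=
  NormedSpace.induced ℂ (SobolevPlus s M N) _ weightMap

theorem norm_sq_eq (U : SobolevPlus s M N) :
    ‖U‖ ^ 2 = ∑ k, ∑ j, ∑' n : ℤ, (1 + (n : ℝ) ^ 2) ^ s * ‖coeff (toL2 U) n k j‖ ^ 2 := by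
  have h : ‖U‖ = ‖weightMap U‖ := rfl
  rw [h, PiLp.norm_sq_eq_of_L2, Fintype.sum_prod_type]
  refine Finset.sum_congr rfl fun k _ => Finset.sum_congr rfl fun j _ => ?_
  have h2 := lp.norm_rpow_eq_tsum (p := 2) (by norm_num) (weightMap U (k, j))
  norm_num at h2
  rw [h2]
  refine tsum_congr fun n => ?_
  rw [weightMap_apply, norm_mul, mul_pow, Complex.norm_real, Real.norm_eq_abs, sq_abs, weight,
    ← Real.rpow_natCast, ← Real.rpow_mul (by positivity)]
  norm_num

end SobolevPlus

/-- `‖U‖_{L^∞}`, with `‖U‖²_{L^∞} = ∑_{k,j} ‖U_{kj}‖²_{L^∞}`, as an extended real. -/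
def linftyNorm {M N : ℕ} (U : L2 M N) : ℝ≥0∞ :=
  (∑ k, ∑ j, eLpNorm (U (k, j) : Torus → ℂ) ∞ (haarAddCircle (T := 2 * Real.pi)) ^ 2) ^
    (1 / 2 : ℝ)

/-! ### The equation -/

/-- `U ∈ C^∞(ℝ; H^s₊)` and `i ∂_t U = Π_{≥0}(U U^* U)` for all times. (For `s > 1/2` the elements
of `H^s` are bounded, so that `U U^* U` is in `L²`.) -/
structure IsSmoothSolution {s : ℝ} {M N : ℕ} (U : ℝ → SobolevPlus s M N) : Prop where
  contDiff : ContDiff ℝ ∞ U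
  equation : ∀ t : ℝ, Complex.I • (deriv U t).toL2 =
    (szego (ofFun fun x =>
      eval (U t).toL2 x * (eval (U t).toL2 x)ᴴ * eval (U t).toL2 x) : L2 M N)

/-! ### Hankel operators -/

/-- The right Hankel operator `F ∈ L²₊(𝕋; ℂ^{d×N}) ↦ Π_{≥0}(U F^*) ∈ L²₊(𝕋; ℂ^{M×d})` of a bounded
symbol `U`. -/
def hankelR {M N : ℕ} (d : ℕ) (U : L2 M N) (F : L2plus d N) : L2plus M d :=
  szego (ofFun fun x => eval U x * (eval (F : L2 d N) x)ᴴ)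

/-- The left Hankel operator `G ∈ L²₊(𝕋; ℂ^{M×d}) ↦ Π_{≥0}(G^* U) ∈ L²₊(𝕋; ℂ^{d×N})` of a bounded
symbol `U`. -/
def hankelL {M N : ℕ} (d : ℕ) (U : L2 M N) (G : L2plus M d) : L2plus d N :=
  szego (ofFun fun x => (eval (G : L2 M d) x)ᴴ * eval U x)

/-- `B` is the positive square root of the operator `T` (it is unique if it exists). -/
structure IsPositiveSqrt {H : Type} [NormedAddCommGroup H] [InnerProductSpace ℂ H]
    (B : H →L[ℂ] H) (T : H → H) : Prop where
  isPositive : B.IsPositive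
  sq : ∀ x, B (B x) = T x

/-- The positive operator `B` is of trace class with trace `τ`: for every orthonormal basis,
`∑_i ⟨B b_i, b_i⟩` converges (unconditionally) to `τ`. -/
def HasTrace {H : Type} [NormedAddCommGroup H] [InnerProductSpace ℂ H]
    (B : H →L[ℂ] H) (τ : ℝ) : Prop :=
  ∀ (ι : Type) (b : HilbertBasis ι ℂ H), HasSum (fun i => ⟪b i, B (b i)⟫_ℂ) (τ : ℂ)

end

end MatrixSzego

open MatrixSzego

/-!
The proof rests on the Lax pair of the matrix Szegő equation and on the trace norm of Hankel
operators.

*Linearisation.* The left Hankel operator is conjugate linear; composing it with the conjugate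
transpose gives the linear operator `L_U : G ↦ Π_{≤ 0}(U^* G)` (`hankel`), and
`𝐇^{(r)}_U 𝐇^{(l)}_U = L_U^* L_U` (`SobolevPlus.hankelR_hankelL_eq`). The trace of its square root is
therefore the trace norm of `L_U`. The trace norm is defined by duality with pairs of Bessel
families (`traceNorm`), which makes the triangle inequality and the ideal property immediate; the
polar decomposition identifies it with the trace of `|L_U|` in every orthonormal basis
(`exists_sqrt_hasTrace`).

*Conservation.* If `i U' = Π_{≥ 0}(U U^* U)`, then `L_{U'} = A L_U + L_U D` with skew-symmetric
bounded `A` and `D` (`hankel_cubic`, `exists_hankel_lax`). As `1 + h A` and `1 + h D` have norm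
`1 + O(h²)`, the trace norm of `L_U + h L_{U'} = (1 + h A) L_U (1 + h D) + O(h²)` exceeds that of
`L_U` by `O(h²)` only. The remainder `L_{U(t+h)} - L_{U(t)} - h L_{U'(t)}` is `o(h)` in trace norm
because `V ↦ L_V` is bounded from `H^s` to the trace class. Hence the trace norm of `L_{U(t)}` has
nonpositive Dini derivatives in both directions of time and is constant
(`IsLaxPath.traceNorm_eq`). No propagator of the Lax equation is needed.

*Upper bound.* The trace norm is at most the sum of the norms of the columns of the block Hankel
matrix `(û(n + m)^*)`, and the `n`-th column is `O((1 + n²)^{-s/2} ‖U‖_{H^s})`; this is summable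
exactly for `s > 1` (`traceNorm_hankel_le`).

*Lower bound.* Testing `L_U` on the (block) diagonal `n = m`, and on the next one, extracts
`∑_n ‖Û(2n)‖_{HS}` and `∑_n ‖Û(2n+1)‖_{HS}`. So `∑_n ‖Û(n)‖_{HS}`, which dominates the `L^∞` norm,
is at most twice the trace norm (`tsum_absCoeff_le`, `linftyNorm_le_tsum_absCoeff`).

*Growth.* The previous points bound the Wiener norm of `U(t)` uniformly by `C ‖U(0)‖_{H^s}`. A tame
estimate for the cubic nonlinearity, in which the Wiener norm takes the place of the `L^∞` norm
(`SobolevPlus.enorm_le_of_cubic`), and Gronwall's inequality give the exponential bound.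
-/

namespace MatrixSzego

/-! ### The trace norm of an operator between Hilbert spaces -/

/-- The Cauchy–Schwarz inequality for series in `[0, ∞]`. -/
theorem ennreal_tsum_mul_le {ι : Type*} (a b : ι → ℝ≥0∞) {X Y : ℝ≥0∞}
    (ha : ∑' i, a i ^ 2 ≤ X ^ 2) (hb : ∑' i, b i ^ 2 ≤ Y ^ 2) : ∑' i, a i * b i ≤ X * Y := by
  have key : ∀ (c : ι → ℝ≥0∞) (Z : ℝ≥0∞) (F : Finset ι), ∑' i, c i ^ 2 ≤ Z ^ 2 →
      (∑ i ∈ F, c i ^ (2 : ℝ)) ^ (1 / (2 : ℝ)) ≤ Z := by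
    intro c Z F h
    calc (∑ i ∈ F, c i ^ (2 : ℝ)) ^ (1 / (2 : ℝ)) ≤ (Z ^ 2) ^ (1 / (2 : ℝ)) := by
          gcongr
          refine le_trans (le_of_eq ?_) ((ENNReal.sum_le_tsum F).trans h)
          exact Finset.sum_congr rfl fun i _ => by norm_cast
      _ = Z := by
          rw [← ENNReal.rpow_natCast, ← ENNReal.rpow_mul]
          norm_num
  rw [ENNReal.tsum_eq_iSup_sum]
  refine iSup_le fun F => ?_
  refine (ENNReal.inner_le_Lp_mul_Lq F a b (Real.HolderConjugate.two_two)).trans ?_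
  exact mul_le_mul' (key a X F ha) (key b Y F hb)

section TraceNorm

variable {V W V' W' : Type*} [NormedAddCommGroup V] [InnerProductSpace ℂ V]
  [NormedAddCommGroup W] [InnerProductSpace ℂ W]
  [NormedAddCommGroup V'] [InnerProductSpace ℂ V']
  [NormedAddCommGroup W'] [InnerProductSpace ℂ W']

/-- A family satisfying Bessel's inequality, i.e. the image of an orthonormal family under a
contraction. -/
def IsBessel {ι : Type*} (e : ι → V) : Prop :=
  ∀ x : V, ∑' i, ‖⟪e i, x⟫_ℂ‖ₑ ^ 2 ≤ ‖x‖ₑ ^ 2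

theorem isBessel_of_orthonormal {ι : Type*} {e : ι → V} (he : Orthonormal ℂ e) : IsBessel e := by
  intro x
  have h1 : ∀ i, ‖⟪e i, x⟫_ℂ‖ₑ ^ 2 = ENNReal.ofReal (‖⟪e i, x⟫_ℂ‖ ^ 2) := fun i => by
    rw [ENNReal.ofReal_pow (norm_nonneg _), ofReal_norm]
  simp_rw [h1]
  rw [← ENNReal.ofReal_tsum_of_nonneg (fun _ => by positivity) (he.inner_products_summable x),
    ← ofReal_norm, ← ENNReal.ofReal_pow (norm_nonneg _)]
  exact ENNReal.ofReal_le_ofReal (he.tsum_inner_products_le x)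

theorem IsBessel.map [CompleteSpace V] [CompleteSpace W] {ι : Type*} {e : ι → V} (he : IsBessel e) (A : V →L[ℂ] W) (hA : ‖A‖ ≤ 1) :
    IsBessel fun i => A (e i) := by
  intro x
  simp_rw [← ContinuousLinearMap.adjoint_inner_right]
  refine (he _).trans ?_
  gcongr
  rw [← ofReal_norm, ← ofReal_norm]
  refine ENNReal.ofReal_le_ofReal ((ContinuousLinearMap.le_opNorm _ _).trans ?_)
  rw [LinearIsometryEquiv.norm_map]
  exact mul_le_of_le_one_left (norm_nonneg _) hA

/-- The trace norm (or nuclear norm) of `L`, by duality: the supremum of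
`∑ |⟨f_i, L e_i⟩|` over all pairs of Bessel families. It is `∞` when `L` is not of trace class. -/
noncomputable def traceNorm (L : V →L[ℂ] W) : ℝ≥0∞ :=
  ⨆ (ι : Type) (e : ι → V) (f : ι → W) (_ : IsBessel e) (_ : IsBessel f),
    ∑' i, ‖⟪f i, L (e i)⟫_ℂ‖ₑ

theorem le_traceNorm (L : V →L[ℂ] W) {ι : Type} {e : ι → V} {f : ι → W}
    (he : IsBessel e) (hf : IsBessel f) : ∑' i, ‖⟪f i, L (e i)⟫_ℂ‖ₑ ≤ traceNorm L :=
  le_iSup_of_le ι <| le_iSup_of_le e <| le_iSup_of_le f <| le_iSup_of_le he <|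
    le_iSup_of_le hf le_rfl

theorem traceNorm_le {L : V →L[ℂ] W} {c : ℝ≥0∞}
    (h : ∀ (ι : Type) (e : ι → V) (f : ι → W), IsBessel e → IsBessel f →
      ∑' i, ‖⟪f i, L (e i)⟫_ℂ‖ₑ ≤ c) : traceNorm L ≤ c :=
  iSup_le fun ι => iSup_le fun e => iSup_le fun f => iSup_le fun he => iSup_le fun hf =>
    h ι e f he hf

theorem traceNorm_add_le (L K : V →L[ℂ] W) : traceNorm (L + K) ≤ traceNorm L + traceNorm K := by
  refine traceNorm_le fun ι e f he hf => ?_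
  refine le_trans ?_ (add_le_add (le_traceNorm L he hf) (le_traceNorm K he hf))
  rw [← ENNReal.tsum_add]
  refine ENNReal.tsum_le_tsum fun i => ?_
  rw [add_apply, inner_add_right]
  exact enorm_add_le _ _

theorem traceNorm_smul_le (c : ℂ) (L : V →L[ℂ] W) : traceNorm (c • L) ≤ ‖c‖ₑ * traceNorm L := by
  refine traceNorm_le fun ι e f he hf => ?_
  refine le_trans (le_of_eq ?_) (mul_le_mul_right (le_traceNorm L he hf) _)
  rw [← ENNReal.tsum_mul_left]
  refine tsum_congr fun i => ?_
  rw [smul_apply, inner_smul_right, enorm_mul]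

theorem traceNorm_comp_le_of_contraction [CompleteSpace V] [CompleteSpace W]
    [CompleteSpace V'] [CompleteSpace W'] (A : W →L[ℂ] W') (L : V →L[ℂ] W) (D : V' →L[ℂ] V)
    (hA : ‖A‖ ≤ 1) (hD : ‖D‖ ≤ 1) : traceNorm (A ∘L L ∘L D) ≤ traceNorm L := by
  refine traceNorm_le fun ι e f he hf => ?_
  have hA' : ‖ContinuousLinearMap.adjoint A‖ ≤ 1 := by rwa [LinearIsometryEquiv.norm_map]
  refine le_trans (le_of_eq ?_) (le_traceNorm L (he.map D hD) (hf.map _ hA'))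
  simp [ContinuousLinearMap.adjoint_inner_left]

theorem norm_inv_smul_le_one {T : V →L[ℂ] W} {r : ℝ} (hr : 0 < r) (hT : ‖T‖ ≤ r) :
    ‖((r⁻¹ : ℝ) : ℂ) • T‖ ≤ 1 := by
  rw [norm_smul, Complex.norm_real, norm_inv, Real.norm_of_nonneg hr.le, inv_mul_le_one₀ hr]
  exact hT

/-- The ideal property of the trace norm. -/
theorem traceNorm_comp_le [CompleteSpace V] [CompleteSpace W]
    [CompleteSpace V'] [CompleteSpace W'] (A : W →L[ℂ] W') (L : V →L[ℂ] W) (D : V' →L[ℂ] V) {a c : ℝ}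
    (ha : 0 < a) (hc : 0 < c) (hA : ‖A‖ ≤ a) (hD : ‖D‖ ≤ c) :
    traceNorm (A ∘L L ∘L D) ≤ ENNReal.ofReal (a * c) * traceNorm L := by
  have h : A ∘L L ∘L D = ((a * c : ℝ) : ℂ) •
      ((((a⁻¹ : ℝ) : ℂ) • A) ∘L L ∘L (((c⁻¹ : ℝ) : ℂ) • D)) := by
    ext x
    simp only [ContinuousLinearMap.comp_apply, smul_apply, map_smul, smul_smul]
    rw [← Complex.ofReal_mul, ← Complex.ofReal_mul]
    have : a * c * (c⁻¹ * a⁻¹) = 1 := by field_simp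
    rw [this, Complex.ofReal_one, one_smul]
  rw [h]
  refine (traceNorm_smul_le _ _).trans ?_
  have : ‖((a * c : ℝ) : ℂ)‖ₑ = ENNReal.ofReal (a * c) := by
    rw [← ofReal_norm, Complex.norm_real, Real.norm_of_nonneg (by positivity)]
  rw [this]
  gcongr
  exact traceNorm_comp_le_of_contraction _ _ _ (norm_inv_smul_le_one ha hA)
    (norm_inv_smul_le_one hc hD)

/-- The trace norm is controlled by the norms of the images of an orthonormal basis. -/
theorem traceNorm_le_tsum_enorm {κ : Type*} (b : HilbertBasis κ ℂ V) (L : V →L[ℂ] W) :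
    traceNorm L ≤ ∑' j, ‖L (b j)‖ₑ := by
  refine traceNorm_le fun ι e f he hf => ?_
  have h1 : ∀ i, ‖⟪f i, L (e i)⟫_ℂ‖ₑ ≤ ∑' j, ‖⟪e i, b j⟫_ℂ‖ₑ * ‖⟪f i, L (b j)⟫_ℂ‖ₑ := by
    intro i
    have h := ((b.hasSum_repr (e i)).mapL L).mapL (innerSL ℂ (f i))
    rw [innerSL_apply_apply] at h
    rw [← h.tsum_eq]
    refine enorm_tsum_le_tsum_enorm.trans (ENNReal.tsum_le_tsum fun j => ?_)
    rw [innerSL_apply_apply, map_smul, inner_smul_right, enorm_mul, b.repr_apply_apply,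
      ← inner_conj_symm]
    simp only [RCLike.enorm_conj, le_refl]
  calc ∑' i, ‖⟪f i, L (e i)⟫_ℂ‖ₑ ≤ ∑' i, ∑' j, ‖⟪e i, b j⟫_ℂ‖ₑ * ‖⟪f i, L (b j)⟫_ℂ‖ₑ :=
        ENNReal.tsum_le_tsum h1
    _ = ∑' j, ∑' i, ‖⟪e i, b j⟫_ℂ‖ₑ * ‖⟪f i, L (b j)⟫_ℂ‖ₑ := ENNReal.tsum_comm
    _ ≤ ∑' j, ‖L (b j)‖ₑ := by
        refine ENNReal.tsum_le_tsum fun j => ?_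
        refine (ennreal_tsum_mul_le _ _ (he (b j)) (hf (L (b j)))).trans (le_of_eq ?_)
        have : ‖b j‖ₑ = 1 := by rw [← ofReal_norm, b.orthonormal.1 j, ENNReal.ofReal_one]
        rw [this, one_mul]

theorem enorm_sq_eq_tsum {κ : Type*} (b : HilbertBasis κ ℂ V) (x : V) :
    ‖x‖ₑ ^ 2 = ∑' j, ‖⟪b j, x⟫_ℂ‖ₑ ^ 2 := by
  have h1 : ∀ i, ‖⟪b i, x⟫_ℂ‖ₑ ^ 2 = ENNReal.ofReal (‖⟪b i, x⟫_ℂ‖ ^ 2) := fun i => by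
    rw [ENNReal.ofReal_pow (norm_nonneg _), ofReal_norm]
  simp_rw [h1]
  rw [← ENNReal.ofReal_tsum_of_nonneg (fun _ => by positivity)
    (b.orthonormal.inner_products_summable x), ← ofReal_norm, ← ENNReal.ofReal_pow (norm_nonneg _)]
  congr 1
  have h := b.hasSum_inner_mul_inner x x
  have h2 := (Complex.reCLM.hasSum h).tsum_eq
  simp only [Complex.reCLM_apply] at h2
  rw [← RCLike.re_eq_complex_re, inner_self_eq_norm_sq] at h2
  rw [← h2]
  refine tsum_congr fun j => ?_
  rw [← inner_conj_symm, ← Complex.normSq_eq_conj_mul_self, Complex.normSq_eq_norm_sq]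
  exact (Complex.ofReal_re _).symm

/-- The polar decomposition: if `B` is self-adjoint with `B² = L^* L`, then `L = P B` and
`B = P^* L` for some contraction `P`. -/
theorem exists_polar [CompleteSpace V] [CompleteSpace W] (L : V →L[ℂ] W) (B : V →L[ℂ] V)
    (hB : IsSelfAdjoint B) (hBL : ∀ x, B (B x) = ContinuousLinearMap.adjoint L (L x)) :
    ∃ P : V →L[ℂ] W, ‖P‖ ≤ 1 ∧ (∀ x, P (B x) = L x) ∧
      ∀ x, ContinuousLinearMap.adjoint P (L x) = B x := by
  have hsym : ∀ x y, ⟪B x, y⟫_ℂ = ⟪x, B y⟫_ℂ := fun x y => by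
    rw [← ContinuousLinearMap.adjoint_inner_right, hB.adjoint_eq]
  have hnorm : ∀ x, ‖L x‖ = ‖B x‖ := by
    intro x
    have h : ⟪L x, L x⟫_ℂ = ⟪B x, B x⟫_ℂ := by
      rw [hsym, hBL, ContinuousLinearMap.adjoint_inner_right]
    rw [inner_self_eq_norm_sq_to_K, inner_self_eq_norm_sq_to_K] at h
    have h' : ‖L x‖ ^ 2 = ‖B x‖ ^ 2 := by exact_mod_cast h
    exact (sq_eq_sq₀ (norm_nonneg _) (norm_nonneg _)).mp h'
  set K : Submodule ℂ V := (LinearMap.range B.toLinearMap).topologicalClosure with hK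
  have hmem : ∀ x, B x ∈ K := fun x => Submodule.le_topologicalClosure _ ⟨x, rfl⟩
  have : CompleteSpace K := (Submodule.isClosed_topologicalClosure _).completeSpace_coe
  set e : V →ₗ[ℂ] K := B.toLinearMap.codRestrict K hmem with he
  have hdense : DenseRange e := by
    intro y
    rw [Metric.mem_closure_iff]
    intro ε hε
    have hy : (y : V) ∈ closure (LinearMap.range B.toLinearMap : Set V) := by
      rw [← Submodule.topologicalClosure_coe]
      exact y.2
    rw [Metric.mem_closure_iff] at hy
    obtain ⟨_, ⟨x, rfl⟩, hx⟩ := hy ε hε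
    exact ⟨e x, ⟨x, rfl⟩, hx⟩
  have hLe : ∀ x, ‖L.toLinearMap x‖ ≤ 1 * ‖e x‖ := fun x => by
    rw [one_mul]
    exact (hnorm x).le
  set P : V →L[ℂ] W := (L.toLinearMap.extendOfNorm e) ∘L K.orthogonalProjectionOnto with hP
  have hP1 : ‖P‖ ≤ 1 := by
    refine (ContinuousLinearMap.opNorm_comp_le _ _).trans ?_
    exact mul_le_one₀ (LinearMap.opNorm_extendOfNorm_le hdense zero_le_one hLe) (norm_nonneg _)
      (Submodule.orthogonalProjectionOnto_norm_le _)
  have hPB : ∀ x, P (B x) = L x := by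
    intro x
    have h1 : K.orthogonalProjectionOnto (B x) = e x :=
      Submodule.orthogonalProjectionOnto_mem_subspace_eq_self (e x)
    rw [hP, ContinuousLinearMap.comp_apply, h1]
    exact LinearMap.extendOfNorm_eq hdense ⟨1, hLe⟩ x
  refine ⟨P, hP1, hPB, fun x => ?_⟩
  -- `P^* P` is a contraction which preserves `⟨B x, B x⟩`, so it fixes `B x`.
  set y := B x
  set z := ContinuousLinearMap.adjoint P (L x) with hz
  have hzy : ‖z‖ ≤ ‖y‖ := by
    refine (ContinuousLinearMap.le_opNorm _ _).trans ?_
    rw [LinearIsometryEquiv.norm_map, hnorm]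
    exact mul_le_of_le_one_left (norm_nonneg _) hP1
  have hin : ⟪z, y⟫_ℂ = ((‖y‖ : ℂ)) ^ 2 := by
    rw [hz, ContinuousLinearMap.adjoint_inner_left, hPB, inner_self_eq_norm_sq_to_K, hnorm]
    rfl
  have h2 : ‖z - y‖ ^ 2 ≤ 0 := by
    rw [@norm_sub_sq ℂ, hin]
    have : RCLike.re (((‖y‖ : ℂ)) ^ 2) = ‖y‖ ^ 2 := by
      rw [← Complex.ofReal_pow]
      exact Complex.ofReal_re _
    rw [this]
    nlinarith [norm_nonneg z, norm_nonneg y]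
  have h3 : ‖z - y‖ = 0 := by nlinarith [norm_nonneg (z - y)]
  exact sub_eq_zero.mp (norm_eq_zero.mp h3)

/-- If `C` is self-adjoint, the sum of `|⟨C g_i, C h_i⟩|` over Bessel families is at most
the squared Hilbert–Schmidt norm of `C`. -/
theorem tsum_inner_le_hilbertSchmidt [CompleteSpace V] {κ ι : Type*} (b : HilbertBasis κ ℂ V)
    {C : V →L[ℂ] V} (hC : IsSelfAdjoint C) {g h : ι → V} (hg : IsBessel g) (hh : IsBessel h) :
    ∑' i, ‖⟪C (g i), C (h i)⟫_ℂ‖ₑ ≤ ∑' j, ‖C (b j)‖ₑ ^ 2 := by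
  have key : ∀ {k : ι → V}, IsBessel k → ∑' i, ‖C (k i)‖ₑ ^ 2 ≤ ∑' j, ‖C (b j)‖ₑ ^ 2 := by
    intro k hk
    have h1 : ∀ i, ‖C (k i)‖ₑ ^ 2 = ∑' j, ‖⟪k i, C (b j)⟫_ℂ‖ₑ ^ 2 := by
      intro i
      rw [enorm_sq_eq_tsum b]
      refine tsum_congr fun j => ?_
      rw [← ContinuousLinearMap.adjoint_inner_left, hC.adjoint_eq, ← inner_conj_symm,
        RCLike.enorm_conj]
    simp_rw [h1]
    rw [ENNReal.tsum_comm]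
    exact ENNReal.tsum_le_tsum fun j => hk (C (b j))
  set S := ∑' j, ‖C (b j)‖ₑ ^ 2 with hS
  have hsq : (S ^ (1 / 2 : ℝ)) ^ 2 = S := by
    rw [← ENNReal.rpow_natCast, ← ENNReal.rpow_mul]
    norm_num
  calc ∑' i, ‖⟪C (g i), C (h i)⟫_ℂ‖ₑ ≤ ∑' i, ‖C (g i)‖ₑ * ‖C (h i)‖ₑ := by
        refine ENNReal.tsum_le_tsum fun i => ?_
        simp_rw [← ofReal_norm]
        rw [← ENNReal.ofReal_mul (norm_nonneg _)]
        exact ENNReal.ofReal_le_ofReal (norm_inner_le_norm _ _)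
    _ ≤ S ^ (1 / 2 : ℝ) * S ^ (1 / 2 : ℝ) :=
        ennreal_tsum_mul_le _ _ ((key hg).trans hsq.ge) ((key hh).trans hsq.ge)
    _ = S := by rw [← sq, hsq]

/-- In any orthonormal basis, the trace of the positive square root of `L^* L` is the trace norm
of `L`. -/
theorem tsum_inner_sqrt_eq_traceNorm [CompleteSpace V] [CompleteSpace W] {κ : Type}
    (b : HilbertBasis κ ℂ V) (L : V →L[ℂ] W) (B : V →L[ℂ] V) (hB : B.IsPositive)
    (hBL : ∀ x, B (B x) = ContinuousLinearMap.adjoint L (L x)) :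
    ∑' j, ‖⟪b j, B (b j)⟫_ℂ‖ₑ = traceNorm L := by
  obtain ⟨P, hP1, hPB, hPL⟩ := exists_polar L B hB.isSelfAdjoint hBL
  have hb : IsBessel b := isBessel_of_orthonormal b.orthonormal
  apply le_antisymm
  · refine le_trans (le_of_eq (tsum_congr fun j => ?_)) (le_traceNorm L hb (hb.map P hP1))
    rw [← hPL, ContinuousLinearMap.adjoint_inner_right]
  · -- With `C = √B`, one has `⟨f, L e⟩ = ⟨C P^* f, C e⟩`.
    have hB0 : 0 ≤ B := (ContinuousLinearMap.nonneg_iff_isPositive B).mpr hB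
    set C : V →L[ℂ] V := CFC.sqrt B with hCdef
    have hC : IsSelfAdjoint C := (CFC.sqrt_nonneg B).isSelfAdjoint
    have hCC : ∀ x, C (C x) = B x := fun x =>
      congrArg (fun T : V →L[ℂ] V => T x) (CFC.sqrt_mul_sqrt_self B hB0)
    have hCin : ∀ x y, ⟪C x, C y⟫_ℂ = ⟪x, B y⟫_ℂ := fun x y => by
      rw [← hCC, ← ContinuousLinearMap.adjoint_inner_right, hC.adjoint_eq]
    refine traceNorm_le fun ι e f he hf => ?_
    have hP1' : ‖ContinuousLinearMap.adjoint P‖ ≤ 1 := by rwa [LinearIsometryEquiv.norm_map]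
    calc ∑' i, ‖⟪f i, L (e i)⟫_ℂ‖ₑ
        = ∑' i, ‖⟪C (ContinuousLinearMap.adjoint P (f i)), C (e i)⟫_ℂ‖ₑ := by
          refine tsum_congr fun i => ?_
          rw [hCin, ContinuousLinearMap.adjoint_inner_left, hPB]
      _ ≤ ∑' j, ‖C (b j)‖ₑ ^ 2 := tsum_inner_le_hilbertSchmidt b hC (hf.map _ hP1') he
      _ = ∑' j, ‖⟪b j, B (b j)⟫_ℂ‖ₑ := by
          refine tsum_congr fun j => ?_
          rw [← hCin, inner_self_eq_norm_sq_to_K, enorm_pow]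
          simp [← ofReal_norm]

open scoped ComplexOrder in
/-- The modulus of a trace class operator: it is the positive square root of `L^* L`, and its
trace is the trace norm. -/
theorem exists_sqrt_hasTrace {V W : Type} [NormedAddCommGroup V] [InnerProductSpace ℂ V]
    [NormedAddCommGroup W] [InnerProductSpace ℂ W] [CompleteSpace V] [CompleteSpace W]
    (L : V →L[ℂ] W) (hL : traceNorm L ≠ ⊤) :
    ∃ B : V →L[ℂ] V, IsPositiveSqrt B (fun x => ContinuousLinearMap.adjoint L (L x)) ∧
      HasTrace B (traceNorm L).toReal := by
  set T : V →L[ℂ] V := ContinuousLinearMap.adjoint L ∘L L with hT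
  have hT0 : 0 ≤ T := (ContinuousLinearMap.nonneg_iff_isPositive T).mpr
    (ContinuousLinearMap.isPositive_adjoint_comp_self L)
  have hB : (CFC.sqrt T).IsPositive :=
    (ContinuousLinearMap.nonneg_iff_isPositive _).mp (CFC.sqrt_nonneg T)
  have hBB : ∀ x, CFC.sqrt T (CFC.sqrt T x) = ContinuousLinearMap.adjoint L (L x) := fun x =>
    congrArg (fun S : V →L[ℂ] V => S x) (CFC.sqrt_mul_sqrt_self T hT0)
  refine ⟨CFC.sqrt T, ⟨hB, hBB⟩, fun ι b => ?_⟩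
  have h := tsum_inner_sqrt_eq_traceNorm b L _ hB hBB
  have hre : ∀ i, ⟪b i, CFC.sqrt T (b i)⟫_ℂ = ((‖⟪b i, CFC.sqrt T (b i)⟫_ℂ‖ : ℝ) : ℂ) := by
    intro i
    have h0 : (0 : ℂ) ≤ ⟪b i, CFC.sqrt T (b i)⟫_ℂ := hB.inner_nonneg_right (b i)
    have h1 := Complex.eq_coe_norm_of_nonneg h0
    exact h1
  have hsum : Summable fun i => ‖⟪b i, CFC.sqrt T (b i)⟫_ℂ‖ :=
    tsum_enorm_ne_top_iff_summable_norm.mp (h ▸ hL)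
  have h2 : ∑' i, ‖⟪b i, CFC.sqrt T (b i)⟫_ℂ‖ = (traceNorm L).toReal := by
    rw [← h, ENNReal.tsum_toReal_eq (fun _ => enorm_ne_top)]
    simp
  rw [← h2, funext hre]
  exact Complex.hasSum_ofReal.mpr hsum.hasSum

end TraceNorm

/-! ### Conservation of the trace norm along a Lax equation -/

section Lax

variable {V W : Type*} [NormedAddCommGroup V] [InnerProductSpace ℂ V]
  [NormedAddCommGroup W] [InnerProductSpace ℂ W]

/-- A skew-symmetric perturbation changes the norm of the identity only to second order. -/
theorem norm_one_add_smul_skew_le {A : V →L[ℂ] V} (hA : ∀ x, (⟪x, A x⟫_ℂ).re = 0) (h : ℝ) :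
    ‖ContinuousLinearMap.id ℂ V + (h : ℂ) • A‖ ≤ 1 + h ^ 2 * ‖A‖ ^ 2 := by
  refine ContinuousLinearMap.opNorm_le_bound _ (by positivity) fun x => ?_
  have h1 : ‖x + (h : ℂ) • A x‖ ^ 2 = ‖x‖ ^ 2 + h ^ 2 * ‖A x‖ ^ 2 := by
    rw [@norm_add_sq ℂ, inner_smul_right, norm_smul, Complex.norm_real, mul_pow, Real.norm_eq_abs,
      sq_abs]
    have : RCLike.re ((h : ℂ) * ⟪x, A x⟫_ℂ) = 0 := by
      rw [RCLike.re_eq_complex_re, Complex.re_ofReal_mul, hA, mul_zero]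
    rw [this]
    ring
  have h2 : ‖A x‖ ^ 2 ≤ ‖A‖ ^ 2 * ‖x‖ ^ 2 := by
    rw [← mul_pow]
    gcongr
    exact A.le_opNorm x
  rw [add_apply, smul_apply, ContinuousLinearMap.id_apply]
  refine abs_le_of_sq_le_sq' ?_ (by positivity) |>.2
  rw [h1]
  have h3 : h ^ 2 * ‖A x‖ ^ 2 ≤ h ^ 2 * (‖A‖ ^ 2 * ‖x‖ ^ 2) := by gcongr
  have h4 : 0 ≤ (h ^ 2 * ‖A‖ ^ 2) * ‖x‖ ^ 2 := by positivity
  have h5 : 0 ≤ (h ^ 2 * ‖A‖ ^ 2) ^ 2 * ‖x‖ ^ 2 := by positivity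
  nlinarith

/-- Along an infinitesimal step `L ↦ L + h (A L + L D)` with `A` and `D` skew-symmetric the trace
norm grows at most to second order in `h`: the step agrees with `(1 + h A) L (1 + h D)` up to
`h² A L D`. -/
theorem exists_traceNorm_lax_step_le [CompleteSpace V] [CompleteSpace W] (L : V →L[ℂ] W)
    (A : W →L[ℂ] W) (D : V →L[ℂ] V)
    (hA : ∀ x, (⟪x, A x⟫_ℂ).re = 0) (hD : ∀ x, (⟪x, D x⟫_ℂ).re = 0) :
    ∃ K : ℝ, 0 ≤ K ∧ ∀ h : ℝ, |h| ≤ 1 → traceNorm (L + (h : ℂ) • (A ∘L L + L ∘L D)) ≤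
      ENNReal.ofReal (1 + K * h ^ 2) * traceNorm L := by
  set a := ‖A‖
  set c := ‖D‖
  refine ⟨a ^ 2 + c ^ 2 + a ^ 2 * c ^ 2 + (a + 1) * (c + 1), by positivity, fun h hh => ?_⟩
  have hsplit : L + (h : ℂ) • (A ∘L L + L ∘L D) =
      (ContinuousLinearMap.id ℂ W + (h : ℂ) • A) ∘L L ∘L (ContinuousLinearMap.id ℂ V + (h : ℂ) • D)
        + ((-(h ^ 2) : ℝ) : ℂ) • (A ∘L L ∘L D) := by
    ext x
    simp only [add_apply, smul_apply, ContinuousLinearMap.comp_apply, ContinuousLinearMap.id_apply,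
      map_add, map_smul, smul_add, smul_smul]
    push_cast
    rw [neg_smul, sq]
    abel
  rw [hsplit]
  refine (traceNorm_add_le _ _).trans ?_
  have h1 := traceNorm_comp_le _ L _ (a := 1 + h ^ 2 * a ^ 2) (c := 1 + h ^ 2 * c ^ 2)
    (by positivity) (by positivity) (norm_one_add_smul_skew_le hA h)
    (norm_one_add_smul_skew_le hD h)
  have h2 := traceNorm_comp_le A L D (a := a + 1) (c := c + 1)
    (by positivity) (by positivity) (le_add_of_nonneg_right zero_le_one)
    (le_add_of_nonneg_right zero_le_one)
  have h3 : ‖((-(h ^ 2) : ℝ) : ℂ)‖ₑ = ENNReal.ofReal (h ^ 2) := by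
    rw [← ofReal_norm, Complex.norm_real, norm_neg, Real.norm_of_nonneg (sq_nonneg h)]
  refine (add_le_add h1 ((traceNorm_smul_le _ _).trans (mul_le_mul_right h2 _))).trans ?_
  rw [h3, ← mul_assoc, ← ENNReal.ofReal_mul (sq_nonneg h), ← add_mul,
    ← ENNReal.ofReal_add (by positivity) (by positivity)]
  refine mul_le_mul' (ENNReal.ofReal_le_ofReal ?_) le_rfl
  have hh2 : h ^ 2 ≤ 1 := by
    rw [← sq_abs]
    exact pow_le_one₀ (abs_nonneg h) hh
  have h4 : h ^ 2 * (h ^ 2 * (a ^ 2 * c ^ 2)) ≤ 1 * (h ^ 2 * (a ^ 2 * c ^ 2)) := by gcongr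
  nlinarith

/-- `L` solves a Lax equation `L' = A L + L D` with skew-symmetric `A(t)` and `D(t)`, the
derivative being taken in the trace norm. -/
def IsLaxPath (L : ℝ → V →L[ℂ] W) : Prop :=
  ∀ t, ∃ (A : W →L[ℂ] W) (D : V →L[ℂ] V),
    (∀ x, (⟪x, A x⟫_ℂ).re = 0) ∧ (∀ x, (⟪x, D x⟫_ℂ).re = 0) ∧
    ∀ ε > 0, ∃ δ > 0, ∀ h : ℝ, |h| < δ →
      traceNorm (L (t + h) - L t - (h : ℂ) • (A ∘L L t + L t ∘L D)) ≤ ENNReal.ofReal (ε * |h|)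

theorem IsLaxPath.comp_neg {L : ℝ → V →L[ℂ] W} (hL : IsLaxPath L) :
    IsLaxPath fun t => L (-t) := by
  intro t
  obtain ⟨A, D, hA, hD, h⟩ := hL (-t)
  refine ⟨-A, -D, fun x => ?_, fun x => ?_, fun ε hε => ?_⟩
  · rw [neg_apply, inner_neg_right, Complex.neg_re, hA, neg_zero]
  · rw [neg_apply, inner_neg_right, Complex.neg_re, hD, neg_zero]
  · obtain ⟨δ, hδ, hδ'⟩ := h ε hε
    refine ⟨δ, hδ, fun u hu => ?_⟩
    have h1 := hδ' (-u) (by rwa [abs_neg])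
    rw [abs_neg] at h1
    refine le_of_eq_of_le (congrArg traceNorm ?_) h1
    simp only [neg_add]
    ext x
    simp only [sub_apply, add_apply, smul_apply, ContinuousLinearMap.comp_apply,
      neg_apply, map_neg, Complex.ofReal_neg, neg_smul, smul_add, smul_neg]

theorem IsLaxPath.continuous [CompleteSpace V] [CompleteSpace W] {L : ℝ → V →L[ℂ] W}
    (hL : IsLaxPath L) (hfin : ∀ t, traceNorm (L t) ≠ ⊤) :
    Continuous fun t => (traceNorm (L t)).toReal := by
  rw [continuous_iff_continuousAt]
  intro t
  obtain ⟨A, D, hA, hD, h⟩ := hL t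
  obtain ⟨δ, hδ, hδ'⟩ := h 1 one_pos
  obtain ⟨R, hR0, hR⟩ : ∃ R : ℝ, 0 ≤ R ∧
      traceNorm (A ∘L L t + L t ∘L D) ≤ ENNReal.ofReal R := by
    have h1 := traceNorm_comp_le A (L t) (ContinuousLinearMap.id ℂ V) (a := ‖A‖ + 1) (c := 1)
      (by positivity) one_pos (le_add_of_nonneg_right zero_le_one)
      ContinuousLinearMap.norm_id_le
    have h2 := traceNorm_comp_le (ContinuousLinearMap.id ℂ W) (L t) D (a := 1) (c := ‖D‖ + 1)
      one_pos (by positivity) ContinuousLinearMap.norm_id_le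
      (le_add_of_nonneg_right zero_le_one)
    refine ⟨_, ENNReal.toReal_nonneg, ((traceNorm_add_le _ _).trans (add_le_add h1 h2)).trans
      (ENNReal.ofReal_toReal ?_).ge⟩
    exact ENNReal.add_ne_top.mpr ⟨ENNReal.mul_ne_top ENNReal.ofReal_ne_top (hfin t),
      ENNReal.mul_ne_top ENNReal.ofReal_ne_top (hfin t)⟩
  have hdiff : ∀ u : ℝ, |u| < δ → traceNorm (L (t + u) - L t) ≤ ENNReal.ofReal ((1 + R) * |u|) := by
    intro u hu
    have h1 : L (t + u) - L t = (L (t + u) - L t - (u : ℂ) • (A ∘L L t + L t ∘L D))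
        + (u : ℂ) • (A ∘L L t + L t ∘L D) := by abel
    rw [h1]
    refine (traceNorm_add_le _ _).trans ((add_le_add (hδ' u hu)
      ((traceNorm_smul_le _ _).trans (mul_le_mul_right hR _))).trans (le_of_eq ?_))
    rw [← ofReal_norm, Complex.norm_real, Real.norm_eq_abs,
      ← ENNReal.ofReal_mul (abs_nonneg u), ← ENNReal.ofReal_add (by positivity) (by positivity)]
    congr 1
    ring
  have habs : ∀ z : ℝ, |z - t| < δ →
      |(traceNorm (L z)).toReal - (traceNorm (L t)).toReal| ≤ (1 + R) * |z - t| := by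
    intro z hz
    have h0 := hdiff (z - t) hz
    rw [add_sub_cancel] at h0
    have h1 : traceNorm (L z) ≤ traceNorm (L t) + ENNReal.ofReal ((1 + R) * |z - t|) := by
      refine le_trans ?_ (add_le_add_right h0 _)
      refine le_trans (le_of_eq ?_) (traceNorm_add_le _ _)
      rw [add_sub_cancel]
    have h2 : traceNorm (L t) ≤ traceNorm (L z) + ENNReal.ofReal ((1 + R) * |z - t|) := by
      have h3 : traceNorm ((-1 : ℂ) • (L z - L t)) ≤ ENNReal.ofReal ((1 + R) * |z - t|) := by
        refine (traceNorm_smul_le _ _).trans ?_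
        rw [enorm_neg, enorm_one, one_mul]
        exact h0
      refine le_trans ?_ (add_le_add_right h3 _)
      refine le_trans (le_of_eq ?_) (traceNorm_add_le _ _)
      rw [neg_one_smul, neg_sub, add_sub_cancel]
    have hpos : 0 ≤ (1 + R) * |z - t| := by positivity
    have h1' := ENNReal.toReal_mono (ENNReal.add_ne_top.mpr ⟨hfin t, ENNReal.ofReal_ne_top⟩) h1
    have h2' := ENNReal.toReal_mono (ENNReal.add_ne_top.mpr ⟨hfin z, ENNReal.ofReal_ne_top⟩) h2
    rw [ENNReal.toReal_add (hfin _) ENNReal.ofReal_ne_top, ENNReal.toReal_ofReal hpos] at h1' h2'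
    rw [abs_le]
    constructor <;> linarith
  rw [Metric.continuousAt_iff]
  intro ε hε
  refine ⟨min δ (ε / (1 + R)), lt_min hδ (by positivity), fun z hz => ?_⟩
  rw [Real.dist_eq] at hz ⊢
  have h1 : |z - t| < ε / (1 + R) := hz.trans_le (min_le_right _ _)
  rw [lt_div_iff₀ (by positivity)] at h1
  refine (habs z (hz.trans_le (min_le_left _ _))).trans_lt ?_
  linarith

/-- The trace norm has a nonpositive right Dini derivative along a Lax equation. -/
theorem IsLaxPath.toReal_traceNorm_antitone [CompleteSpace V] [CompleteSpace W]
    {L : ℝ → V →L[ℂ] W} (hL : IsLaxPath L) (hfin : ∀ t, traceNorm (L t) ≠ ⊤) {a b : ℝ}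
    (hab : a ≤ b) : (traceNorm (L b)).toReal ≤ (traceNorm (L a)).toReal := by
  refine image_le_of_liminf_slope_right_le_deriv_boundary
    (f := fun t => (traceNorm (L t)).toReal) (B := fun _ => (traceNorm (L a)).toReal)
    (B' := fun _ => 0) (hL.continuous hfin).continuousOn le_rfl continuousOn_const
    (fun x _ => hasDerivWithinAt_const _ _ _) ?_ ⟨hab, le_rfl⟩
  intro x _ r hr
  apply Filter.Eventually.frequently
  obtain ⟨A, D, hA, hD, h⟩ := hL x
  obtain ⟨K, hK0, hK⟩ := exists_traceNorm_lax_step_le (L x) A D hA hD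
  obtain ⟨δ, hδ, hδ'⟩ := h (r / 2) (by positivity)
  set f0 := (traceNorm (L x)).toReal with hf0
  have hf0pos : 0 ≤ f0 := ENNReal.toReal_nonneg
  set η := min (min δ 1) (r / 2 / (K * f0 + 1)) with hη
  have hηpos : 0 < η := lt_min (lt_min hδ one_pos) (by positivity)
  filter_upwards [Ioo_mem_nhdsGT (show x < x + η by linarith)] with z hz
  set u := z - x with hu
  have hu0 : 0 < u := by linarith [hz.1]
  have huη : u < η := by linarith [hz.2]
  have hzx : z = x + u := by rw [hu]; ring
  have huδ : |u| < δ := by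
    rw [abs_of_pos hu0]
    exact huη.trans_le ((min_le_left _ _).trans (min_le_left _ _))
  have hu1 : |u| ≤ 1 := by
    rw [abs_of_pos hu0]
    exact (huη.trans_le ((min_le_left _ _).trans (min_le_right _ _))).le
  have hu2 : u * (K * f0 + 1) < r / 2 := by
    rw [← lt_div_iff₀ (by positivity)]
    exact huη.trans_le (min_le_right _ _)
  have h1 : traceNorm (L z) ≤ ENNReal.ofReal (1 + K * u ^ 2) * traceNorm (L x)
      + ENNReal.ofReal (r / 2 * |u|) := by
    refine le_trans ?_ (add_le_add (hK u hu1) (hδ' u huδ))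
    refine le_trans (le_of_eq ?_) (traceNorm_add_le _ _)
    rw [hzx]
    congr 1
    abel
  have h2 := ENNReal.toReal_mono (ENNReal.add_ne_top.mpr
    ⟨ENNReal.mul_ne_top ENNReal.ofReal_ne_top (hfin x), ENNReal.ofReal_ne_top⟩) h1
  rw [ENNReal.toReal_add (ENNReal.mul_ne_top ENNReal.ofReal_ne_top (hfin x))
    ENNReal.ofReal_ne_top, ENNReal.toReal_mul, ENNReal.toReal_ofReal (by positivity),
    ENNReal.toReal_ofReal (by positivity), abs_of_pos hu0, ← hf0] at h2
  rw [slope_def_field, div_lt_iff₀ hu0]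
  have h3 : u * (u * (K * f0 + 1)) < u * (r / 2) := by gcongr
  have h4 : 0 < u * u := by positivity
  show (traceNorm (L z)).toReal - f0 < r * u
  nlinarith

/-- The trace norm is conserved along a Lax equation. -/
theorem IsLaxPath.traceNorm_eq [CompleteSpace V] [CompleteSpace W]
    {L : ℝ → V →L[ℂ] W} (hL : IsLaxPath L) (hfin : ∀ t, traceNorm (L t) ≠ ⊤) (a b : ℝ) :
    traceNorm (L a) = traceNorm (L b) := by
  have key : ∀ {a b : ℝ}, a ≤ b → (traceNorm (L a)).toReal = (traceNorm (L b)).toReal := by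
    intro a b hab
    refine le_antisymm ?_ (hL.toReal_traceNorm_antitone hfin hab)
    have h := hL.comp_neg.toReal_traceNorm_antitone (fun t => hfin (-t)) (neg_le_neg hab)
    simpa only [neg_neg] using h
  refine (ENNReal.toReal_eq_toReal_iff' (hfin a) (hfin b)).mp ?_
  rcases le_total a b with h | h
  · exact key h
  · exact (key h).symm

end Lax

/-! ### Fourier modes and frequency projections -/

section Modes

variable {M N : ℕ}

/-- The matrix function `e^{inx} E_{kj}` for `p = (k, j)`. -/
noncomputable def mode (n : ℤ) (p : Fin M × Fin N) : L2 M N :=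
  PiLp.single 2 p (fourierBasis (T := 2 * Real.pi) n)

theorem inner_mode (n : ℤ) (p : Fin M × Fin N) (U : L2 M N) :
    ⟪mode n p, U⟫_ℂ = coeff U n p.1 p.2 := by
  rw [coeff_apply_eq_repr, HilbertBasis.repr_apply_apply, PiLp.inner_apply,
    Finset.sum_eq_single p]
  · simp [mode]
  · intro q _ hq
    simp [mode, hq]
  · simp

theorem coeff_mode (n m : ℤ) (p q : Fin M × Fin N) :
    coeff (mode n p) m q.1 q.2 = if m = n ∧ q = p then 1 else 0 := by
  rw [coeff_apply_eq_repr]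
  by_cases h : q = p
  · subst h
    have h1 : (mode n q : L2 M N) q = fourierBasis (T := 2 * Real.pi) n := by
      simp only [mode, PiLp.single_eq_same]
    rw [Prod.mk.eta, h1, HilbertBasis.repr_self, lp.single_apply, Pi.single_apply]
    simp
  · simp [mode, h]

theorem orthonormal_mode :
    Orthonormal ℂ fun i : ℤ × (Fin M × Fin N) => (mode i.1 i.2 : L2 M N) := by
  rw [orthonormal_iff_ite]
  rintro ⟨n, p⟩ ⟨m, q⟩
  simp only [inner_mode, coeff_mode, Prod.mk.injEq]

theorem coeff_sub (U V : L2 M N) (n : ℤ) : coeff (U - V) n = coeff U n - coeff V n := by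
  ext k j
  simp [coeff_apply_eq_repr]

/-- The orthonormal basis `e^{inx} E_{kj}` of `L²(𝕋; ℂ^{M×N})`. -/
noncomputable def modeBasis : HilbertBasis (ℤ × (Fin M × Fin N)) ℂ (L2 M N) :=
  HilbertBasis.mkOfOrthogonalEqBot orthonormal_mode (by
    rw [Submodule.eq_bot_iff]
    intro U hU
    apply ext_coeff
    intro n
    ext k j
    rw [coeff_zero, Matrix.zero_apply, ← inner_mode n (k, j)]
    exact hU _ (Submodule.subset_span ⟨(n, (k, j)), rfl⟩))

theorem modeBasis_apply (i : ℤ × (Fin M × Fin N)) : modeBasis i = mode i.1 i.2 := by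
  rw [modeBasis, HilbertBasis.coe_mkOfOrthogonalEqBot]

/-- Parseval's identity. -/
theorem enorm_sq_eq_tsum_coeff (U : L2 M N) :
    ‖U‖ₑ ^ 2 = ∑ p : Fin M × Fin N, ∑' n, ‖coeff U n p.1 p.2‖ₑ ^ 2 := by
  rw [enorm_sq_eq_tsum modeBasis]
  simp only [modeBasis_apply, inner_mode]
  rw [ENNReal.tsum_prod (f := fun n (p : Fin M × Fin N) => ‖coeff U n p.1 p.2‖ₑ ^ 2),
    ENNReal.tsum_comm, tsum_fintype]

theorem mode_mem_L2plus (n : ℕ) (p : Fin M × Fin N) : (mode (n : ℤ) p : L2 M N) ∈ L2plus M N := by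
  intro m hm
  ext k j
  rw [coeff_mode n m p (k, j), if_neg (by omega), Matrix.zero_apply]

/-- The element `e^{inx} E_{kj}`, `n ≥ 0`, of `L²₊(𝕋; ℂ^{M×N})`. -/
noncomputable def modePlus (i : ℕ × (Fin M × Fin N)) : L2plus M N :=
  ⟨mode (i.1 : ℤ) i.2, mode_mem_L2plus i.1 i.2⟩

theorem orthonormal_modePlus : Orthonormal ℂ (modePlus (M := M) (N := N)) := by
  rw [orthonormal_iff_ite]
  rintro ⟨n, p⟩ ⟨m, q⟩
  rw [Submodule.coe_inner]
  simp only [modePlus, inner_mode, coeff_mode, Prod.mk.injEq, Nat.cast_inj]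

theorem coeff_modePlus_inner (i : ℕ × (Fin M × Fin N)) (U : L2plus M N) :
    ⟪modePlus i, U⟫_ℂ = coeff (U : L2 M N) i.1 i.2.1 i.2.2 := by
  rw [Submodule.coe_inner]
  exact inner_mode _ _ _

theorem span_modePlus_orthogonal :
    (Submodule.span ℂ (Set.range (modePlus (M := M) (N := N))))ᗮ = ⊥ := by
  rw [Submodule.eq_bot_iff]
  intro U hU
  rw [Submodule.mem_orthogonal] at hU
  apply Subtype.ext
  apply ext_coeff
  intro n
  rcases lt_or_ge n 0 with hn | hn
  · rw [U.2 n hn]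
    exact (coeff_zero n).symm
  · lift n to ℕ using hn
    ext k j
    have h := hU (modePlus (n, (k, j))) (Submodule.subset_span ⟨_, rfl⟩)
    rw [coeff_modePlus_inner] at h
    rw [h]
    exact (congrFun (congrFun (coeff_zero (n : ℤ)) k) j).symm

/-- The orthonormal basis `e^{inx} E_{kj}`, `n ≥ 0`, of `L²₊(𝕋; ℂ^{M×N})`. -/
noncomputable def modePlusBasis : HilbertBasis (ℕ × (Fin M × Fin N)) ℂ (L2plus M N) :=
  HilbertBasis.mkOfOrthogonalEqBot orthonormal_modePlus span_modePlus_orthogonal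

theorem modePlusBasis_apply (i : ℕ × (Fin M × Fin N)) : modePlusBasis i = modePlus i := by
  rw [modePlusBasis, HilbertBasis.coe_mkOfOrthogonalEqBot]

variable (M N) in
/-- The elements of `L²(𝕋; ℂ^{M×N})` whose frequencies lie in `S`, as an orthogonal complement. -/
noncomputable def freqSubspace (S : Set ℤ) : Submodule ℂ (L2 M N) :=
  (Submodule.span ℂ {U | ∃ n ∉ S, ∃ p, U = mode n p})ᗮ

theorem mem_freqSubspace {S : Set ℤ} {U : L2 M N} :
    U ∈ freqSubspace M N S ↔ ∀ n ∉ S, coeff U n = 0 := by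
  constructor
  · intro hU n hn
    ext k j
    rw [Matrix.zero_apply, ← inner_mode n (k, j)]
    exact hU _ (Submodule.subset_span ⟨n, hn, _, rfl⟩)
  · intro hU
    rw [freqSubspace, Submodule.mem_orthogonal]
    intro V hV
    induction hV using Submodule.span_induction with
    | mem V hV =>
      obtain ⟨n, hn, p, rfl⟩ := hV
      rw [inner_mode, hU n hn, Matrix.zero_apply]
    | zero => exact inner_zero_left _
    | add V W _ _ hV hW => rw [inner_add_left, hV, hW, add_zero]
    | smul c V _ hV => rw [inner_smul_left, hV, mul_zero]

instance (S : Set ℤ) : CompleteSpace (freqSubspace M N S) :=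
  (Submodule.isClosed_orthogonal _).completeSpace_coe

/-- The Fourier multiplier `Π_S`, the orthogonal projection onto the frequencies in `S`. -/
noncomputable def freqProj (S : Set ℤ) : L2 M N →L[ℂ] L2 M N :=
  (freqSubspace M N S).starProjection

theorem coeff_freqProj_of_mem {S : Set ℤ} (U : L2 M N) {n : ℤ} (hn : n ∈ S) :
    coeff (freqProj S U) n = coeff U n := by
  ext k j
  have hmode : (mode n (k, j) : L2 M N) ∈ freqSubspace M N S := by
    rw [mem_freqSubspace]
    intro m hm
    ext k' j'
    rw [coeff_mode n m (k, j) (k', j'), if_neg, Matrix.zero_apply]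
    rintro ⟨rfl, -⟩
    exact hm hn
  have h := (freqSubspace M N S).starProjection_inner_eq_zero U _ hmode
  rw [← inner_conj_symm, inner_sub_right, map_eq_zero, sub_eq_zero, inner_mode, inner_mode] at h
  exact h.symm

theorem coeff_freqProj_of_notMem {S : Set ℤ} (U : L2 M N) {n : ℤ} (hn : n ∉ S) :
    coeff (freqProj S U) n = 0 :=
  mem_freqSubspace.mp ((freqSubspace M N S).starProjection_apply_mem U) n hn

theorem inner_freqProj_left (S : Set ℤ) (U V : L2 M N) :
    ⟪freqProj S U, V⟫_ℂ = ⟪U, freqProj S V⟫_ℂ :=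
  (freqSubspace M N S).inner_starProjection_left_eq_right U V

theorem freqProj_of_mem {S : Set ℤ} {U : L2 M N} (h : ∀ n ∉ S, coeff U n = 0) :
    freqProj S U = U :=
  Submodule.starProjection_eq_self_iff.mpr (mem_freqSubspace.mpr h)

theorem coe_szego (U : L2 M N) : (szego U : L2 M N) = freqProj (Set.Ici 0) U := by
  apply ext_coeff
  intro n
  rw [coeff_szego]
  split_ifs with hn
  · exact (coeff_freqProj_of_mem U (Set.mem_Ici.mpr hn)).symm
  · exact (coeff_freqProj_of_notMem U fun h => hn (Set.mem_Ici.mp h)).symm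

theorem szego_eq_orthogonalProjection (U : L2 M N) :
    szego U = (L2plus M N).orthogonalProjectionOnto U := by
  apply Subtype.ext
  rw [Submodule.coe_orthogonalProjectionOnto_apply]
  refine (Submodule.eq_starProjection_of_mem_of_inner_eq_zero (szego U).2 fun V hV => ?_).symm
  have h : freqProj (Set.Ici 0) V = V := freqProj_of_mem fun n hn => hV n (not_le.mp hn)
  rw [coe_szego, inner_sub_left, inner_freqProj_left, h, sub_self]

end Modes

/-! ### Multiplication by continuous symbols -/

section Mul

theorem memLp_mul (f : C(Torus, ℂ)) (g : ScalarL2) :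
    MemLp (fun x => f x * g x) 2 (haarAddCircle (T := 2 * Real.pi)) :=
  (Lp.memLp g).of_le_mul (c := ‖f‖)
    (f.continuous.aestronglyMeasurable.mul (Lp.aestronglyMeasurable g))
    (Filter.Eventually.of_forall fun x => by
      rw [norm_mul]
      exact mul_le_mul_of_nonneg_right (f.norm_coe_le_norm x) (norm_nonneg _))

/-- Multiplication by a continuous function on `L²(𝕋)`. -/
noncomputable def scalarMul (f : C(Torus, ℂ)) : ScalarL2 →L[ℂ] ScalarL2 :=
  LinearMap.mkContinuous
    { toFun := fun g => (memLp_mul f g).toLp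
      map_add' := fun g h => by
        apply Lp.ext
        filter_upwards [(memLp_mul f (g + h)).coeFn_toLp, (memLp_mul f g).coeFn_toLp,
          (memLp_mul f h).coeFn_toLp, Lp.coeFn_add g h,
          Lp.coeFn_add (memLp_mul f g).toLp (memLp_mul f h).toLp] with x h1 h2 h3 h4 h5
        rw [h1, h5, Pi.add_apply, h2, h3, h4, Pi.add_apply, mul_add]
      map_smul' := fun c g => by
        apply Lp.ext
        filter_upwards [(memLp_mul f (c • g)).coeFn_toLp, (memLp_mul f g).coeFn_toLp,
          Lp.coeFn_smul c g, Lp.coeFn_smul c (memLp_mul f g).toLp] with x h1 h2 h4 h5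
        rw [h1, RingHom.id_apply, h5, Pi.smul_apply, h2, h4, Pi.smul_apply, smul_eq_mul,
          smul_eq_mul]
        ring } ‖f‖
    (fun g => by
      apply Lp.norm_le_mul_norm_of_ae_le_mul
      filter_upwards [(memLp_mul f g).coeFn_toLp] with x h1
      simp only [LinearMap.coe_mk, AddHom.coe_mk]
      rw [h1, norm_mul]
      exact mul_le_mul_of_nonneg_right (f.norm_coe_le_norm x) (norm_nonneg _))

theorem coeFn_scalarMul (f : C(Torus, ℂ)) (g : ScalarL2) :
    (scalarMul f g : Torus → ℂ) =ᵐ[haarAddCircle] fun x => f x * g x :=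
  (memLp_mul f g).coeFn_toLp

theorem inner_scalarMul_left (f : C(Torus, ℂ)) (g h : ScalarL2) :
    ⟪scalarMul f g, h⟫_ℂ = ⟪g, scalarMul (star f) h⟫_ℂ := by
  rw [L2.inner_def, L2.inner_def]
  apply integral_congr_ae
  filter_upwards [coeFn_scalarMul f g, coeFn_scalarMul (star f) h] with x h1 h2
  rw [h1, h2, RCLike.inner_apply, RCLike.inner_apply, map_mul]
  simp only [ContinuousMap.star_apply, RCLike.star_def]
  ring

theorem scalarMul_mul (f g : C(Torus, ℂ)) (h : ScalarL2) :
    scalarMul (f * g) h = scalarMul f (scalarMul g h) := by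
  apply Lp.ext
  filter_upwards [coeFn_scalarMul (f * g) h, coeFn_scalarMul f (scalarMul g h),
    coeFn_scalarMul g h] with x h1 h2 h3
  rw [h1, h2, h3, ContinuousMap.mul_apply, mul_assoc]

theorem scalarMul_add (f g : C(Torus, ℂ)) (h : ScalarL2) :
    scalarMul (f + g) h = scalarMul f h + scalarMul g h := by
  apply Lp.ext
  filter_upwards [coeFn_scalarMul (f + g) h, coeFn_scalarMul f h, coeFn_scalarMul g h,
    Lp.coeFn_add (scalarMul f h) (scalarMul g h)] with x h1 h2 h3 h4
  rw [h1, h4, Pi.add_apply, h2, h3, ContinuousMap.add_apply, add_mul]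

theorem scalarMul_smul (c : ℂ) (f : C(Torus, ℂ)) (h : ScalarL2) :
    scalarMul (c • f) h = c • scalarMul f h := by
  apply Lp.ext
  filter_upwards [coeFn_scalarMul (c • f) h, coeFn_scalarMul f h,
    Lp.coeFn_smul c (scalarMul f h)] with x h1 h2 h4
  rw [h1, h4, Pi.smul_apply, h2, ContinuousMap.smul_apply, smul_eq_mul, smul_eq_mul, mul_assoc]

theorem scalarMul_sum {ι : Type*} (s : Finset ι) (f : ι → C(Torus, ℂ)) (h : ScalarL2) :
    scalarMul (∑ i ∈ s, f i) h = ∑ i ∈ s, scalarMul (f i) h := by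
  classical
  induction s using Finset.induction_on with
  | empty =>
    have := scalarMul_smul 0 0 h
    rwa [zero_smul, zero_smul] at this
  | insert a s ha ih => rw [Finset.sum_insert ha, Finset.sum_insert ha, scalarMul_add, ih]

/-- The Fourier coefficients of a product are the convolution of the Fourier coefficients. -/
theorem hasSum_fourierCoeff_scalarMul (f : C(Torus, ℂ)) (g : ScalarL2) (n : ℤ) :
    HasSum (fun k => fourierCoeff f (n - k) * fourierCoeff (g : Torus → ℂ) k)
      (fourierCoeff (scalarMul f g : Torus → ℂ) n) := by
  rw [← fourierBasis_repr, HilbertBasis.repr_apply_apply, ← star_star f, ← inner_scalarMul_left]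
  have h := fourierBasis.hasSum_inner_mul_inner
    (scalarMul (star f) (fourierBasis (T := 2 * Real.pi) n)) g
  refine h.congr_fun fun k => ?_
  rw [← fourierBasis_repr g, HilbertBasis.repr_apply_apply]
  congr 1
  rw [inner_scalarMul_left, star_star, L2.inner_def, fourierCoeff]
  apply integral_congr_ae
  filter_upwards [coeFn_scalarMul f (fourierBasis (T := 2 * Real.pi) k),
    (coe_fourierBasis (T := 2 * Real.pi)) ▸ coeFn_fourierLp (T := 2 * Real.pi) 2 n,
    (coe_fourierBasis (T := 2 * Real.pi)) ▸ coeFn_fourierLp (T := 2 * Real.pi) 2 k] with x h1 h2 h3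
  rw [h1, RCLike.inner_apply, h2, h3, smul_eq_mul, neg_sub, sub_eq_add_neg k n,
    fourier_add, fourier_neg]
  ring

end Mul

section MatMul

variable {M N K d : ℕ}

/-- The element of `L²(𝕋; ℂ^{M×N})` given by a matrix of continuous functions. -/
noncomputable def contL2 (a : Matrix (Fin M) (Fin N) C(Torus, ℂ)) : L2 M N :=
  WithLp.toLp 2 fun p => ContinuousMap.toLp (E := ℂ) 2 haarAddCircle ℂ (a p.1 p.2)

theorem coeff_contL2 (a : Matrix (Fin M) (Fin N) C(Torus, ℂ)) (n : ℤ) (k : Fin M) (j : Fin N) :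
    coeff (contL2 a) n k j = fourierCoeff (a k j) n :=
  fourierCoeff_toLp (a k j) n

theorem eval_contL2 (a : Matrix (Fin M) (Fin N) C(Torus, ℂ)) :
    ∀ᵐ x ∂haarAddCircle, eval (contL2 a) x = Matrix.of fun k j => a k j x := by
  have h : ∀ p : Fin M × Fin N, ∀ᵐ x ∂haarAddCircle,
      (contL2 a p : Torus → ℂ) x = a p.1 p.2 x := fun p =>
    ContinuousMap.coeFn_toLp (E := ℂ) (p := 2) haarAddCircle (𝕜 := ℂ) (a p.1 p.2)
  filter_upwards [ae_all_iff.mpr h] with x hx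
  ext k j
  exact hx (k, j)

/-- Multiplication `G ↦ a G` by a matrix of continuous functions. -/
noncomputable def matMul (a : Matrix (Fin M) (Fin N) C(Torus, ℂ)) : L2 N d →L[ℂ] L2 M d :=
  (PiLp.continuousLinearEquiv 2 ℂ (fun _ : Fin M × Fin d => ScalarL2)).symm.toContinuousLinearMap ∘L
    ContinuousLinearMap.pi fun p => ∑ j, scalarMul (a p.1 j) ∘L PiLp.proj 2 _ (j, p.2)

theorem matMul_apply (a : Matrix (Fin M) (Fin N) C(Torus, ℂ)) (G : L2 N d) (p : Fin M × Fin d) :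
    matMul a G p = ∑ j, scalarMul (a p.1 j) (G (j, p.2)) := by
  simp [matMul]

theorem matMul_mul (a : Matrix (Fin M) (Fin N) C(Torus, ℂ)) (b : Matrix (Fin N) (Fin K) C(Torus, ℂ))
    (G : L2 K d) : matMul (a * b) G = matMul a (matMul b G) := by
  ext1 p
  simp only [matMul_apply, Matrix.mul_apply, scalarMul_sum, map_sum, scalarMul_mul]
  rw [Finset.sum_comm]

theorem matMul_add (a b : Matrix (Fin M) (Fin N) C(Torus, ℂ)) (G : L2 N d) :
    matMul (a + b) G = matMul a G + matMul b G := by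
  ext1 p
  simp only [matMul_apply, Matrix.add_apply, scalarMul_add, Finset.sum_add_distrib, PiLp.add_apply]

theorem matMul_smul (c : ℂ) (a : Matrix (Fin M) (Fin N) C(Torus, ℂ)) (G : L2 N d) :
    matMul (c • a) G = c • matMul a G := by
  ext1 p
  simp only [matMul_apply, Matrix.smul_apply, scalarMul_smul, Finset.smul_sum, PiLp.smul_apply]

theorem inner_matMul_left (a : Matrix (Fin M) (Fin N) C(Torus, ℂ)) (G : L2 N d) (H : L2 M d) :
    ⟪matMul a G, H⟫_ℂ = ⟪G, matMul aᴴ H⟫_ℂ := by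
  simp only [PiLp.inner_apply, matMul_apply, sum_inner, inner_sum, inner_scalarMul_left,
    Matrix.conjTranspose_apply, Fintype.sum_prod_type]
  rw [Finset.sum_comm]
  conv_rhs => rw [Finset.sum_comm]
  exact Finset.sum_congr rfl fun e _ => Finset.sum_comm

theorem eval_matMul (a : Matrix (Fin M) (Fin N) C(Torus, ℂ)) (G : L2 N d) :
    ∀ᵐ x ∂haarAddCircle, eval (matMul a G) x = (Matrix.of fun k j => a k j x) * eval G x := by
  have h : ∀ p : Fin M × Fin d, ∀ᵐ x ∂haarAddCircle,
      (matMul a G p : Torus → ℂ) x = ∑ j, a p.1 j x * (G (j, p.2) : Torus → ℂ) x := by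
    intro p
    have h1 : ∀ j, ∀ᵐ x ∂haarAddCircle, (scalarMul (a p.1 j) (G (j, p.2)) : Torus → ℂ) x =
      a p.1 j x * (G (j, p.2) : Torus → ℂ) x := fun j => coeFn_scalarMul _ _
    rw [matMul_apply]
    filter_upwards [ae_all_iff.mpr h1, Lp.coeFn_finsetSum Finset.univ
      fun j => scalarMul (a p.1 j) (G (j, p.2))] with x hx hs
    rw [hs, Finset.sum_apply]
    exact Finset.sum_congr rfl fun j _ => hx j
  filter_upwards [ae_all_iff.mpr h] with x hx
  ext k e
  rw [Matrix.mul_apply]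
  exact hx (k, e)

/-- A square integrable function is recovered from its values. -/
theorem ofFun_eq {f : Torus → Matrix (Fin M) (Fin N) ℂ} {U : L2 M N}
    (h : ∀ᵐ x ∂haarAddCircle, f x = eval U x) : ofFun f = U := by
  ext1 p
  have hp : (fun x => f x p.1 p.2) =ᵐ[haarAddCircle] (U p : Torus → ℂ) := by
    filter_upwards [h] with x hx
    rw [hx]
    rfl
  have hmem : MemLp (fun x => f x p.1 p.2) 2 (haarAddCircle (T := 2 * Real.pi)) :=
    (memLp_congr_ae hp).mpr (Lp.memLp (U p))
  have h1 : ofFun f p = hmem.toLp := by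
    simp only [ofFun]
    rw [dif_pos hmem]
  rw [h1]
  apply Lp.ext
  filter_upwards [hmem.coeFn_toLp, hp] with x h2 h3
  rw [h2, h3]

theorem coeff_matMul (a : Matrix (Fin M) (Fin N) C(Torus, ℂ)) (G : L2 N d) (n : ℤ) (k : Fin M)
    (e : Fin d) : coeff (matMul a G) n k e =
      ∑ j, fourierCoeff (scalarMul (a k j) (G (j, e)) : Torus → ℂ) n := by
  rw [coeff_apply_eq_repr, matMul_apply, map_sum, lp.coeFn_sum, Finset.sum_apply]
  simp only [fourierBasis_repr]

/-- The frequencies of a product are sums of frequencies of the factors. -/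
theorem coeff_matMul_eq_zero (a : Matrix (Fin M) (Fin N) C(Torus, ℂ)) (G : L2 N d) (n : ℤ)
    (h : ∀ l, (∀ k j, fourierCoeff (a k j) (n - l) = 0) ∨ coeff G l = 0) :
    coeff (matMul a G) n = 0 := by
  ext k e
  rw [coeff_matMul, Matrix.zero_apply]
  refine Finset.sum_eq_zero fun j _ => ?_
  rw [← (hasSum_fourierCoeff_scalarMul _ _ _).tsum_eq]
  refine (tsum_congr fun l => ?_).trans tsum_zero
  rcases h l with h | h
  · rw [h, zero_mul]
  · have h2 : fourierCoeff (G (j, e) : Torus → ℂ) l = 0 := congrFun (congrFun h j) e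
    rw [h2, mul_zero]

theorem fourierCoeff_star (f : C(Torus, ℂ)) (n : ℤ) :
    fourierCoeff ((star f : C(Torus, ℂ)) : Torus → ℂ) n = star (fourierCoeff f (-n)) := by
  simp only [fourierCoeff, RCLike.star_def]
  rw [← integral_conj]
  refine integral_congr_ae (Filter.Eventually.of_forall fun x => ?_)
  simp only [smul_eq_mul, map_mul, ContinuousMap.star_apply, RCLike.star_def, neg_neg]
  rw [fourier_neg]

end MatMul

/-! ### Continuous symbols of Sobolev functions -/

section Symbol

variable {M N : ℕ} {s : ℝ}

/-- The weight `(1 + n²)^{s/2}` as an extended nonnegative real. -/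
noncomputable def eweight (s : ℝ) (n : ℤ) : ℝ≥0∞ := ENNReal.ofReal (weight s n)

theorem SobolevPlus.enorm_sq_eq (U : SobolevPlus s M N) : ‖U‖ₑ ^ 2 =
    ∑ p : Fin M × Fin N, ∑' n, (eweight s n * ‖coeff U.toL2 n p.1 p.2‖ₑ) ^ 2 := by
  have h : ‖U‖ₑ = ‖SobolevPlus.weightMap U‖ₑ := by
    rw [← ofReal_norm, ← ofReal_norm]
    rfl
  rw [h, ← ofReal_norm, ← ENNReal.ofReal_pow (norm_nonneg _), PiLp.norm_sq_eq_of_L2,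
    ENNReal.ofReal_sum_of_nonneg fun _ _ => by positivity]
  refine Finset.sum_congr rfl fun p _ => ?_
  have h2 := lp.norm_rpow_eq_tsum (p := 2) (by norm_num) (SobolevPlus.weightMap U p)
  have h3 := (lp.memℓp (SobolevPlus.weightMap U p)).summable (by norm_num)
  norm_num at h2 h3
  rw [h2, ENNReal.ofReal_tsum_of_nonneg (fun _ => by positivity) h3]
  refine tsum_congr fun n => ?_
  rw [SobolevPlus.weightMap_apply, ENNReal.ofReal_pow (norm_nonneg _), norm_mul,
    ENNReal.ofReal_mul (norm_nonneg _), ofReal_norm (coeff U.toL2 n p.1 p.2), Complex.norm_real,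
    Real.norm_of_nonneg (weight_pos s n).le, eweight]

theorem summable_weight_neg {r : ℝ} (hr : 1 < r) : Summable fun n : ℤ => weight (-r) n := by
  have h : Summable fun n : ℤ => |(n : ℝ)| ^ (-r) :=
    Real.summable_abs_int_rpow hr
  refine Summable.of_norm_bounded_eventually h ?_
  rw [Filter.eventually_cofinite]
  refine (Set.finite_singleton (0 : ℤ)).subset fun n hn => ?_
  by_contra hn0
  apply hn
  have h0 : 0 < |(n : ℝ)| := abs_pos.mpr (by exact_mod_cast hn0)
  rw [Real.norm_of_nonneg (weight_pos _ _).le, weight]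
  have h1 : |(n : ℝ)| ^ (-r) = ((n : ℝ) ^ 2) ^ (-r / 2) := by
    rw [← sq_abs, ← Real.rpow_natCast, ← Real.rpow_mul h0.le]
    congr 1
    push_cast
    ring
  rw [h1]
  refine Real.rpow_le_rpow_of_nonpos ?_ ?_ (by linarith)
  · rw [← sq_abs]
    positivity
  · linarith

theorem tsum_eweight_neg_ne_top {r : ℝ} (hr : 1 < r) : ∑' n, eweight (-r) n ≠ ⊤ := by
  simp only [eweight]
  rw [← ENNReal.ofReal_tsum_of_nonneg (fun n => (weight_pos _ n).le) (summable_weight_neg hr)]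
  exact ENNReal.ofReal_ne_top

theorem eweight_mul_neg (s : ℝ) (n : ℤ) : eweight (-s) n * eweight s n = 1 := by
  rw [eweight, eweight, ← ENNReal.ofReal_mul (weight_pos _ _).le, weight, weight,
    ← Real.rpow_add (by positivity), neg_div, neg_add_cancel, Real.rpow_zero, ENNReal.ofReal_one]

theorem eweight_sq (s : ℝ) (n : ℤ) : eweight s n ^ 2 = eweight (2 * s) n := by
  rw [eweight, eweight, ← ENNReal.ofReal_pow (weight_pos _ _).le, weight, weight,
    ← Real.rpow_natCast, ← Real.rpow_mul (by positivity)]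
  congr 2
  push_cast
  ring

theorem SobolevPlus.tsum_sq_le (U : SobolevPlus s M N) (p : Fin M × Fin N) :
    ∑' n, (eweight s n * ‖coeff U.toL2 n p.1 p.2‖ₑ) ^ 2 ≤ ‖U‖ₑ ^ 2 := by
  rw [U.enorm_sq_eq]
  exact Finset.single_le_sum
    (f := fun q : Fin M × Fin N => ∑' n, (eweight s n * ‖coeff U.toL2 n q.1 q.2‖ₑ) ^ 2)
    (fun _ _ => zero_le) (Finset.mem_univ p)

theorem SobolevPlus.tsum_enorm_coeff_ne_top (hs : 1 < s) (U : SobolevPlus s M N)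
    (p : Fin M × Fin N) : ∑' n, ‖coeff U.toL2 n p.1 p.2‖ₑ ≠ ⊤ := by
  have h1 : ∀ n, ‖coeff U.toL2 n p.1 p.2‖ₑ =
      eweight (-s) n * (eweight s n * ‖coeff U.toL2 n p.1 p.2‖ₑ) := fun n => by
    rw [← mul_assoc, eweight_mul_neg, one_mul]
  rw [tsum_congr h1]
  set S := ∑' n, eweight (2 * -s) n with hS
  have hS1 : S ≠ ⊤ := by
    have := tsum_eweight_neg_ne_top (r := 2 * s) (by linarith)
    rwa [← mul_neg] at this
  have hS2 : ∑' n, eweight (-s) n ^ 2 ≤ (S ^ (1 / 2 : ℝ)) ^ 2 := by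
    rw [← ENNReal.rpow_natCast, ← ENNReal.rpow_mul]
    simp only [eweight_sq, ← hS]
    norm_num
  refine ((ennreal_tsum_mul_le _ _ hS2 (U.tsum_sq_le p)).trans_lt ?_).ne
  exact ENNReal.mul_lt_top (ENNReal.rpow_lt_top_of_nonneg (by norm_num) hS1) enorm_lt_top

theorem SobolevPlus.summable_coeff (hs : 1 < s) (U : SobolevPlus s M N) (p : Fin M × Fin N) :
    Summable fun n => ‖coeff U.toL2 n p.1 p.2‖ :=
  tsum_enorm_ne_top_iff_summable_norm.mp (U.tsum_enorm_coeff_ne_top hs p)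

/-- The continuous representative of a Sobolev function, the sum of its Fourier series in
`C(𝕋)` (the series converges for `s > 1/2`). -/
noncomputable def SobolevPlus.symbol (U : SobolevPlus s M N) :
    Matrix (Fin M) (Fin N) C(Torus, ℂ) :=
  fun k j => ∑' n : ℤ, coeff U.toL2 n k j • fourier n

theorem SobolevPlus.hasSum_symbol (hs : 1 < s) (U : SobolevPlus s M N) (k : Fin M) (j : Fin N) :
    HasSum (fun n : ℤ => coeff U.toL2 n k j • (fourier n : C(Torus, ℂ))) (U.symbol k j) := by
  refine Summable.hasSum (Summable.of_norm ?_)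
  refine (U.summable_coeff hs (k, j)).congr fun n => ?_
  rw [norm_smul, fourier_norm, mul_one]

theorem SobolevPlus.contL2_symbol (hs : 1 < s) (U : SobolevPlus s M N) :
    contL2 U.symbol = U.toL2 := by
  ext1 ⟨k, j⟩
  have h := (U.hasSum_symbol hs k j).mapL (ContinuousMap.toLp (E := ℂ) 2 haarAddCircle ℂ)
  refine h.unique ?_
  refine (hasSum_fourier_series_L2 (U.toL2 (k, j))).congr_fun fun n => ?_
  rw [map_smul]
  rfl

theorem SobolevPlus.fourierCoeff_symbol (hs : 1 < s) (U : SobolevPlus s M N) (n : ℤ)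
    (k : Fin M) (j : Fin N) : fourierCoeff (U.symbol k j) n = coeff U.toL2 n k j := by
  rw [← coeff_contL2, U.contL2_symbol hs]

theorem SobolevPlus.eval_toL2 (hs : 1 < s) (U : SobolevPlus s M N) :
    ∀ᵐ x ∂haarAddCircle, eval U.toL2 x = Matrix.of fun k j => U.symbol k j x := by
  rw [← U.contL2_symbol hs]
  exact eval_contL2 _

theorem SobolevPlus.coeff_eq_zero (U : SobolevPlus s M N) {n : ℤ} (hn : n < 0) :
    coeff U.toL2 n = 0 :=
  U.2.1 n hn

theorem SobolevPlus.symbol_add (hs : 1 < s) (U V : SobolevPlus s M N) :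
    (U + V).symbol = U.symbol + V.symbol := by
  ext1 k j
  refine (HasSum.unique (((U.hasSum_symbol hs k j).add (V.hasSum_symbol hs k j)).congr_fun ?_)
    ((U + V).hasSum_symbol hs k j)).symm
  intro n
  rw [map_add, coeff_add, Matrix.add_apply, add_smul]

theorem SobolevPlus.symbol_smul (hs : 1 < s) (c : ℂ) (U : SobolevPlus s M N) :
    (c • U).symbol = c • U.symbol := by
  ext1 k j
  refine (HasSum.unique (((U.hasSum_symbol hs k j).const_smul c).congr_fun ?_)
    ((c • U).hasSum_symbol hs k j)).symm
  intro n
  rw [map_smul, coeff_smul, Matrix.smul_apply, smul_smul, smul_eq_mul]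

end Symbol

/-! ### The linearised Hankel operator -/

section Hankel

variable {M N d : ℕ} {s : ℝ}

/-- The pointwise conjugate transpose on `L²`. -/
noncomputable def conjTransposeL2 (U : L2 M N) : L2 N M :=
  WithLp.toLp 2 fun p => star (U (p.2, p.1))

theorem eval_conjTransposeL2 (U : L2 M N) :
    ∀ᵐ x ∂haarAddCircle, eval (conjTransposeL2 U) x = (eval U x)ᴴ := by
  have h : ∀ p : Fin N × Fin M, ∀ᵐ x ∂haarAddCircle,
      (conjTransposeL2 U p : Torus → ℂ) x = star ((U (p.2, p.1) : Torus → ℂ) x) :=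
    fun p => Lp.coeFn_star (U (p.2, p.1))
  filter_upwards [ae_all_iff.mpr h] with x hx
  ext j k
  exact hx (j, k)

theorem coeff_conjTransposeL2 (U : L2 M N) (n : ℤ) :
    coeff (conjTransposeL2 U) n = (coeff U (-n))ᴴ := by
  ext j k
  rw [Matrix.conjTranspose_apply]
  simp only [coeff, fourierCoeff, RCLike.star_def]
  rw [← integral_conj]
  apply integral_congr_ae
  filter_upwards [Lp.coeFn_star (U (k, j))] with x hx
  have h : (conjTransposeL2 U (j, k) : Torus → ℂ) x = star ((U (k, j) : Torus → ℂ) x) := hx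
  rw [h, smul_eq_mul, smul_eq_mul, map_mul, neg_neg, fourier_neg, RCLike.star_def]

variable (d) in
/-- The linear operator `L_u : G ↦ Π_{≤ 0}(u^* G)` on `L²₊(𝕋; ℂ^{M×d})`. Its values are the conjugate
transposes of those of the (conjugate linear) left Hankel operator. -/
noncomputable def hankel (u : Matrix (Fin M) (Fin N) C(Torus, ℂ)) : L2plus M d →L[ℂ] L2 N d :=
  freqProj (Set.Iic 0) ∘L matMul uᴴ ∘L (L2plus M d).subtypeL

theorem hankel_apply (u : Matrix (Fin M) (Fin N) C(Torus, ℂ)) (G : L2plus M d) :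
    hankel d u G = freqProj (Set.Iic 0) (matMul uᴴ (G : L2 M d)) := rfl

theorem hankel_add (u v : Matrix (Fin M) (Fin N) C(Torus, ℂ)) :
    hankel d (u + v) = hankel d u + hankel d v := by
  ext1 G
  rw [add_apply, hankel_apply, hankel_apply, hankel_apply, Matrix.conjTranspose_add, matMul_add,
    map_add]

theorem hankel_smul (c : ℂ) (u : Matrix (Fin M) (Fin N) C(Torus, ℂ)) :
    hankel d (c • u) = star c • hankel d u := by
  ext1 G
  rw [smul_apply, hankel_apply, hankel_apply, Matrix.conjTranspose_smul, matMul_smul, map_smul]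

theorem freqProj_hankel (u : Matrix (Fin M) (Fin N) C(Torus, ℂ)) (G : L2plus M d) :
    freqProj (Set.Iic 0) (hankel d u G) = hankel d u G :=
  freqProj_of_mem fun _ hn => coeff_freqProj_of_notMem _ hn

theorem inner_szego_right (G : L2plus M d) (X : L2 M d) :
    ⟪G, szego X⟫_ℂ = ⟪(G : L2 M d), X⟫_ℂ := by
  rw [szego_eq_orthogonalProjection, Submodule.coe_inner,
    Submodule.coe_orthogonalProjectionOnto_apply, ← Submodule.inner_starProjection_left_eq_right,
    Submodule.starProjection_eq_self_iff.mpr G.2]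

theorem adjoint_hankel (u : Matrix (Fin M) (Fin N) C(Torus, ℂ)) (X : L2 N d) :
    ContinuousLinearMap.adjoint (hankel d u) X = szego (matMul u (freqProj (Set.Iic 0) X)) := by
  refine ext_inner_left ℂ fun G => ?_
  rw [ContinuousLinearMap.adjoint_inner_right, inner_szego_right, hankel_apply,
    inner_freqProj_left, inner_matMul_left, Matrix.conjTranspose_conjTranspose]

theorem SobolevPlus.hankelL_eq (hs : 1 < s) (U : SobolevPlus s M N) (G : L2plus M d) :
    conjTransposeL2 (hankelL d U.toL2 G : L2 d N) = hankel d U.symbol G := by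
  have h1 : ofFun (fun x => (eval (G : L2 M d) x)ᴴ * eval U.toL2 x) =
      conjTransposeL2 (matMul U.symbolᴴ (G : L2 M d)) := by
    apply ofFun_eq
    filter_upwards [eval_conjTransposeL2 (matMul U.symbolᴴ (G : L2 M d)),
      eval_matMul U.symbolᴴ (G : L2 M d), U.eval_toL2 hs] with x h1 h2 h3
    rw [h1, h2, h3, Matrix.conjTranspose_mul]
    congr 1
    ext k j
    simp [Matrix.conjTranspose_apply]
  rw [hankelL, h1, hankel_apply]
  apply ext_coeff
  intro n
  rw [coeff_conjTransposeL2, coeff_szego, coeff_conjTransposeL2, neg_neg]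
  by_cases hn : n ≤ 0
  · rw [if_pos (by omega), coeff_freqProj_of_mem _ (Set.mem_Iic.mpr hn),
      Matrix.conjTranspose_conjTranspose]
  · rw [if_neg (by omega), coeff_freqProj_of_notMem _ (fun h => hn (Set.mem_Iic.mp h)),
      Matrix.conjTranspose_zero]

theorem SobolevPlus.hankelR_hankelL_eq (hs : 1 < s) (U : SobolevPlus s M N) (G : L2plus M d) :
    hankelR d U.toL2 (hankelL d U.toL2 G) =
      ContinuousLinearMap.adjoint (hankel d U.symbol) (hankel d U.symbol G) := by
  rw [adjoint_hankel, freqProj_hankel, hankelR]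
  congr 1
  apply ofFun_eq
  filter_upwards [eval_conjTransposeL2 (hankelL d U.toL2 G : L2 d N),
    eval_matMul U.symbol (hankel d U.symbol G), U.eval_toL2 hs] with x h1 h2 h3
  rw [h2, h3, ← h1, U.hankelL_eq hs]

theorem hankel_eq_zero {u : Matrix (Fin M) (Fin N) C(Torus, ℂ)}
    (h : ∀ n : ℤ, 0 ≤ n → ∀ k j, fourierCoeff (u k j) n = 0) : hankel d u = 0 := by
  ext1 G
  apply ext_coeff
  intro n
  rw [zero_apply, coeff_zero, hankel_apply]
  by_cases hn : n ∈ Set.Iic (0 : ℤ)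
  · rw [coeff_freqProj_of_mem _ hn]
    apply coeff_matMul_eq_zero
    intro l
    rcases lt_or_ge l 0 with hl | hl
    · exact Or.inr (G.2 l hl)
    · refine Or.inl fun j k => ?_
      rw [Matrix.conjTranspose_apply, fourierCoeff_star,
        h _ (by have := Set.mem_Iic.mp hn; omega), star_zero]
  · exact coeff_freqProj_of_notMem _ hn

/-! ### The Lax equation -/

/-- If `u` has no negative frequencies, then
`L_{u u^* u} = S L_u + L_u T - L_u L_u^* L_u` with `S = Π_{≤ 0} u^* u Π_{≤ 0}` and
`T = Π_{≥ 0} u u^*`. -/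
theorem hankel_cubic {u : Matrix (Fin M) (Fin N) C(Torus, ℂ)}
    (hu : ∀ n : ℤ, n < 0 → ∀ k j, fourierCoeff (u k j) n = 0) (G : L2plus M d) :
    hankel d (u * uᴴ * u) G =
      freqProj (Set.Iic 0) (matMul uᴴ (matMul u (freqProj (Set.Iic 0) (hankel d u G)))) +
      hankel d u (szego (matMul u (matMul uᴴ (G : L2 M d)))) -
      hankel d u (ContinuousLinearMap.adjoint (hankel d u) (hankel d u G)) := by
  set Y := matMul uᴴ (G : L2 M d) with hY
  -- `Y - Π_{≤ 0} Y` has positive frequencies only, hence so has its product with `u`.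
  have hZ : matMul u Y - matMul u (hankel d u G) ∈ L2plus M d := by
    intro n hn
    rw [← map_sub]
    apply coeff_matMul_eq_zero
    intro l
    by_cases hl : l ∈ Set.Iic (0 : ℤ)
    · right
      rw [coeff_sub, hankel_apply, coeff_freqProj_of_mem _ hl, sub_self]
    · left
      exact hu _ (by have : 0 < l := not_le.mp hl; omega)
  have hZ' : freqProj (Set.Ici 0) (matMul u Y - matMul u (hankel d u G)) =
      matMul u Y - matMul u (hankel d u G) :=
    freqProj_of_mem fun n hn => hZ n (not_le.mp hn)
  rw [adjoint_hankel, freqProj_hankel, hankel_apply _ (szego (matMul u Y)),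
    hankel_apply u (szego (matMul u (hankel d u G))), coe_szego, coe_szego, add_sub_assoc,
    ← map_sub, ← map_sub, ← map_sub, hZ', ← map_add, ← map_add]
  rw [add_sub_cancel, hankel_apply, Matrix.conjTranspose_mul, Matrix.conjTranspose_mul,
    Matrix.conjTranspose_conjTranspose, matMul_mul, matMul_mul]

/-- `i (R^* R - ½ Q^* Q)` is skew-symmetric. -/
theorem re_inner_skew {V W W' : Type*} [NormedAddCommGroup V] [InnerProductSpace ℂ V]
    [NormedAddCommGroup W] [InnerProductSpace ℂ W] [NormedAddCommGroup W'] [InnerProductSpace ℂ W']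
    [CompleteSpace V] [CompleteSpace W] [CompleteSpace W'] (R : V →L[ℂ] W) (Q : V →L[ℂ] W')
    (x : V) : (⟪x, (Complex.I • (ContinuousLinearMap.adjoint R ∘L R -
      (1 / 2 : ℂ) • (ContinuousLinearMap.adjoint Q ∘L Q))) x⟫_ℂ).re = 0 := by
  rw [smul_apply, sub_apply, smul_apply, ContinuousLinearMap.comp_apply,
    ContinuousLinearMap.comp_apply, inner_smul_right, inner_sub_right, inner_smul_right,
    ContinuousLinearMap.adjoint_inner_right, ContinuousLinearMap.adjoint_inner_right,
    inner_self_eq_norm_sq_to_K, inner_self_eq_norm_sq_to_K]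
  have h : ((‖R x‖ : ℂ)) ^ 2 - 1 / 2 * ((‖Q x‖ : ℂ)) ^ 2 =
      ((‖R x‖ ^ 2 - 1 / 2 * ‖Q x‖ ^ 2 : ℝ) : ℂ) := by
    push_cast
    ring
  have h2 : (Complex.I * (((‖R x‖ : ℂ)) ^ 2 - 1 / 2 * ((‖Q x‖ : ℂ)) ^ 2)).re = 0 := by
    rw [h, Complex.I_mul_re, Complex.ofReal_im, neg_zero]
  exact h2

/-- If `v` is the derivative of `u` prescribed by the matrix Szegő equation, then
`L_v = A L_u + L_u D` with skew-symmetric `A` and `D`. -/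
theorem exists_hankel_lax {u v : Matrix (Fin M) (Fin N) C(Torus, ℂ)}
    (hu : ∀ n : ℤ, n < 0 → ∀ k j, fourierCoeff (u k j) n = 0)
    (huv : hankel d (Complex.I • v) = hankel d (u * uᴴ * u)) :
    ∃ (A : L2 N d →L[ℂ] L2 N d) (D : L2plus M d →L[ℂ] L2plus M d),
      (∀ x, (⟪x, A x⟫_ℂ).re = 0) ∧ (∀ x, (⟪x, D x⟫_ℂ).re = 0) ∧
      hankel d v = A ∘L hankel d u + hankel d u ∘L D := by
  set L := hankel d u with hL
  set R : L2 N d →L[ℂ] L2 M d := matMul u ∘L freqProj (Set.Iic 0) with hR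
  set Q : L2plus M d →L[ℂ] L2 N d := matMul uᴴ ∘L (L2plus M d).subtypeL with hQ
  have hR' : ∀ X, ContinuousLinearMap.adjoint R X = freqProj (Set.Iic 0) (matMul uᴴ X) := by
    intro X
    refine ext_inner_left ℂ fun Y => ?_
    rw [ContinuousLinearMap.adjoint_inner_right, hR, ContinuousLinearMap.comp_apply,
      inner_matMul_left, inner_freqProj_left]
  have hQ' : ∀ X, ContinuousLinearMap.adjoint Q X = szego (matMul u X) := by
    intro X
    refine ext_inner_left ℂ fun Y => ?_
    rw [ContinuousLinearMap.adjoint_inner_right, inner_szego_right, hQ,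
      ContinuousLinearMap.comp_apply, inner_matMul_left, Matrix.conjTranspose_conjTranspose,
      Submodule.subtypeL_apply]
  refine ⟨Complex.I • (ContinuousLinearMap.adjoint R ∘L R - (1 / 2 : ℂ) •
      (ContinuousLinearMap.adjoint (ContinuousLinearMap.adjoint L) ∘L
        ContinuousLinearMap.adjoint L)),
    Complex.I • (ContinuousLinearMap.adjoint Q ∘L Q - (1 / 2 : ℂ) •
      (ContinuousLinearMap.adjoint L ∘L L)), re_inner_skew _ _, re_inner_skew _ _, ?_⟩
  have hv : hankel d v = Complex.I • hankel d (u * uᴴ * u) := by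
    rw [← huv, hankel_smul, smul_smul]
    simp
  rw [hv]
  ext1 G
  have h1 : ContinuousLinearMap.adjoint R (R (L G)) =
      freqProj (Set.Iic 0) (matMul uᴴ (matMul u (freqProj (Set.Iic 0) (hankel d u G)))) := hR' _
  have h2 : ContinuousLinearMap.adjoint Q (Q G) =
      szego (matMul u (matMul uᴴ (G : L2 M d))) := hQ' _
  have h3 : hankel d (u * uᴴ * u) G = ContinuousLinearMap.adjoint R (R (L G)) +
      L (ContinuousLinearMap.adjoint Q (Q G)) - L (ContinuousLinearMap.adjoint L (L G)) := by
    rw [h1, h2]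
    exact hankel_cubic hu G
  simp only [smul_apply, h3, add_apply, ContinuousLinearMap.comp_apply,
    sub_apply, map_smul, map_sub, ContinuousLinearMap.adjoint_adjoint]
  module

end Hankel

/-! ### Upper bound for the trace norm of a Hankel operator -/

section TraceBounds

variable {M N d : ℕ} {s : ℝ}

theorem fourierCoeff_scalarMul_basis (f : C(Torus, ℂ)) (n m : ℤ) :
    fourierCoeff (scalarMul f (fourierBasis (T := 2 * Real.pi) n) : Torus → ℂ) m =
      fourierCoeff f (m - n) := by
  rw [← (hasSum_fourierCoeff_scalarMul _ _ _).tsum_eq, tsum_eq_single n]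
  · rw [← fourierBasis_repr, HilbertBasis.repr_self, lp.single_apply, Pi.single_eq_same, mul_one]
  · intro l hl
    rw [← fourierBasis_repr, HilbertBasis.repr_self, lp.single_apply, Pi.single_eq_of_ne hl,
      mul_zero]

theorem coeff_matMul_mode (a : Matrix (Fin N) (Fin M) C(Torus, ℂ)) (n m : ℤ)
    (k : Fin M) (e e' : Fin d) (j : Fin N) :
    coeff (matMul a (mode n (k, e))) m j e' =
      if e' = e then fourierCoeff (a j k) (m - n) else 0 := by
  rw [coeff_matMul]
  split_ifs with he
  · rw [Finset.sum_eq_single k]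
    · rw [he, mode, PiLp.single_eq_same, fourierCoeff_scalarMul_basis]
    · intro k' _ hk
      have h : (mode n (k, e) : L2 M d) (k', e') = 0 := by
        rw [mode, PiLp.single_eq_of_ne]
        simp [hk]
      rw [h, map_zero, ← fourierBasis_repr, map_zero]
      rfl
    · simp
  · refine Finset.sum_eq_zero fun k' _ => ?_
    have h : (mode n (k, e) : L2 M d) (k', e') = 0 := by
      rw [mode, PiLp.single_eq_of_ne]
      simp [he]
    rw [h, map_zero, ← fourierBasis_repr, map_zero]
    rfl

/-- The matrix of `L_u` in the Fourier basis is the block Hankel matrix of the `û(n + m)^*`. -/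
theorem coeff_hankel_modePlus (u : Matrix (Fin M) (Fin N) C(Torus, ℂ)) (n : ℕ) (m : ℤ)
    (hm : m ≤ 0) (k : Fin M) (e e' : Fin d) (j : Fin N) :
    coeff (hankel d u (modePlus (n, (k, e)))) m j e' =
      if e' = e then star (fourierCoeff (u k j) (n - m)) else 0 := by
  rw [hankel_apply, coeff_freqProj_of_mem _ (Set.mem_Iic.mpr hm), modePlus, coeff_matMul_mode,
    Matrix.conjTranspose_apply, fourierCoeff_star, neg_sub]

theorem eweight_mono (hs : 0 ≤ s) {n m : ℤ} (hn : 0 ≤ n) (hnm : n ≤ m) :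
    eweight s n ≤ eweight s m := by
  refine ENNReal.ofReal_le_ofReal ?_
  rw [weight, weight]
  have h1 : (0 : ℝ) ≤ n := by exact_mod_cast hn
  have h2 : (n : ℝ) ≤ m := by exact_mod_cast hnm
  gcongr

/-- The `n`-th columns of the Hankel matrix decay like `(1 + n²)^{-s/2}`. -/
theorem enorm_hankel_modePlus_le (hs : 1 < s) (U : SobolevPlus s M N)
    (i : ℕ × (Fin M × Fin d)) :
    ‖hankel d U.symbol (modePlus i)‖ₑ ≤ eweight (-s) i.1 * (((N * d : ℕ) : ℝ≥0∞) * ‖U‖ₑ) := by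
  obtain ⟨n, k, e⟩ := i
  have h1 : ∀ q : Fin N × Fin d,
      ∑' m, ‖coeff (hankel d U.symbol (modePlus (n, (k, e)))) m q.1 q.2‖ₑ ^ 2 ≤
        (eweight (-s) n * ‖U‖ₑ) ^ 2 := by
    rintro ⟨j, e'⟩
    have h2 : ∀ m, ‖coeff (hankel d U.symbol (modePlus (n, (k, e)))) m j e'‖ₑ ^ 2 ≤
        eweight (-s) n ^ 2 * (eweight s (n - m) * ‖coeff U.toL2 (n - m) k j‖ₑ) ^ 2 := by
      intro m
      by_cases hm : m ≤ 0
      · rw [coeff_hankel_modePlus _ n m hm]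
        split_ifs
        · rw [U.fourierCoeff_symbol hs, RCLike.star_def, RCLike.enorm_conj, ← mul_pow, ← mul_assoc]
          refine pow_le_pow_left₀ zero_le ?_ 2
          refine le_mul_of_one_le_left zero_le ?_
          rw [← eweight_mul_neg s n]
          exact mul_le_mul_right (eweight_mono (by linarith) (by positivity) (by omega)) _
        · rw [enorm_zero]
          simp
      · rw [← freqProj_hankel, coeff_freqProj_of_notMem _ (fun h => hm (Set.mem_Iic.mp h)),
          Matrix.zero_apply, enorm_zero]
        simp
    refine (ENNReal.tsum_le_tsum h2).trans ?_
    rw [ENNReal.tsum_mul_left, mul_pow]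
    refine mul_le_mul_right ?_ _
    exact ((Equiv.subLeft (n : ℤ)).tsum_eq
      fun m : ℤ => (eweight s m * ‖coeff U.toL2 m k j‖ₑ) ^ 2).trans_le (U.tsum_sq_le (k, j))
  refine (ENNReal.pow_le_pow_left_iff two_ne_zero).mp ?_
  rw [enorm_sq_eq_tsum_coeff]
  refine (Finset.sum_le_sum fun q _ => h1 q).trans ?_
  rw [Finset.sum_const, Finset.card_univ, Fintype.card_prod, Fintype.card_fin, Fintype.card_fin,
    nsmul_eq_mul, mul_left_comm (eweight (-s) _), mul_pow ((N * d : ℕ) : ℝ≥0∞)]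
  refine mul_le_mul_left ?_ _
  exact_mod_cast Nat.le_self_pow two_ne_zero (N * d)

/-- The constant in `Tr |L_U| ≤ C ‖U‖_{H^s}`. -/
noncomputable def hankelConst (s : ℝ) (M N d : ℕ) : ℝ≥0∞ :=
  ((M * d : ℕ) : ℝ≥0∞) * ((∑' n, eweight (-s) n) * ((N * d : ℕ) : ℝ≥0∞))

theorem hankelConst_ne_top (hs : 1 < s) : hankelConst s M N d ≠ ⊤ :=
  ENNReal.mul_ne_top (ENNReal.natCast_ne_top _)
    (ENNReal.mul_ne_top (tsum_eweight_neg_ne_top hs) (ENNReal.natCast_ne_top _))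

theorem traceNorm_hankel_le (hs : 1 < s) (U : SobolevPlus s M N) :
    traceNorm (hankel d U.symbol) ≤ hankelConst s M N d * ‖U‖ₑ := by
  refine (traceNorm_le_tsum_enorm modePlusBasis _).trans ?_
  simp only [modePlusBasis_apply]
  refine (ENNReal.tsum_le_tsum fun i => enorm_hankel_modePlus_le hs U i).trans ?_
  rw [ENNReal.tsum_prod (f := fun (n : ℕ) (_ : Fin M × Fin d) =>
    eweight (-s) n * (((N * d : ℕ) : ℝ≥0∞) * ‖U‖ₑ))]
  simp only [tsum_fintype, Finset.sum_const, Finset.card_univ, Fintype.card_prod, Fintype.card_fin,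
    nsmul_eq_mul]
  rw [ENNReal.tsum_mul_left, ENNReal.tsum_mul_right, hankelConst, mul_assoc, mul_assoc]
  refine mul_le_mul_right (mul_le_mul_left ?_ _) _
  exact ENNReal.tsum_comp_le_tsum_of_injective (f := fun n : ℕ => (n : ℤ)) Nat.cast_injective
    (eweight (-s))

/-! ### Lower bound for the trace norm of a Hankel operator -/

/-- The entrywise absolute values of the Fourier coefficient `Û(n)`; the norm of this vector is the
Hilbert–Schmidt norm of `Û(n)`. -/
noncomputable def absCoeff (U : L2 M N) (n : ℤ) : EuclideanSpace ℝ (Fin M × Fin N) :=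
  WithLp.toLp 2 fun p => ‖coeff U n p.1 p.2‖

theorem norm_absCoeff_sq (U : L2 M N) (n : ℤ) :
    ‖absCoeff U n‖ ^ 2 = ∑ k, ∑ j, ‖coeff U n k j‖ ^ 2 := by
  rw [EuclideanSpace.norm_sq_eq, Fintype.sum_prod_type]
  simp [absCoeff]

/-- The family `∑_j c_{kj} e^{-i(n+r)x} E_{je}`, indexed by `(n, k)`, where `c` is the entrywise
conjugate of `Û(2n+r) / ‖Û(2n+r)‖_{HS}`. If `Û(2n+r) = 0`, then `c = 0` by the convention on
division by zero, and nothing is lost. -/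
noncomputable def testFamily (U : L2 M N) (r : ℕ) (e : Fin d) (i : ℕ × Fin M) : L2 N d :=
  ∑ j, (star (coeff U (2 * i.1 + r) i.2 j) / (‖absCoeff U (2 * i.1 + r)‖ : ℂ)) •
    mode (-(i.1 + r : ℤ)) (j, e)

theorem inner_testFamily (U : L2 M N) (r : ℕ) (e : Fin d) (i : ℕ × Fin M) (X : L2 N d) :
    ⟪testFamily U r e i, X⟫_ℂ = ∑ j, coeff U (2 * i.1 + r) i.2 j /
      (‖absCoeff U (2 * i.1 + r)‖ : ℂ) * coeff X (-(i.1 + r : ℤ)) j e := by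
  rw [testFamily, sum_inner]
  refine Finset.sum_congr rfl fun j _ => ?_
  rw [inner_smul_left, inner_mode]
  simp

/-- Bessel's inequality holds because a matrix of Hilbert–Schmidt norm at most `1` is a
contraction. -/
theorem isBessel_testFamily (U : L2 M N) (r : ℕ) (e : Fin d) :
    IsBessel (testFamily U r e) := by
  intro X
  rw [ENNReal.tsum_prod (f := fun (n : ℕ) (k : Fin M) => ‖⟪testFamily U r e (n, k), X⟫_ℂ‖ₑ ^ 2)]
  have h1 : ∀ n : ℕ, ∑' k, ‖⟪testFamily U r e (n, k), X⟫_ℂ‖ₑ ^ 2 ≤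
      ∑ j, ‖coeff X (-(n + r : ℤ)) j e‖ₑ ^ 2 := by
    intro n
    rw [tsum_fintype]
    simp only [inner_testFamily, ← ofReal_norm]
    simp only [← ENNReal.ofReal_pow (norm_nonneg _)]
    rw [← ENNReal.ofReal_sum_of_nonneg fun _ _ => by positivity,
      ← ENNReal.ofReal_sum_of_nonneg fun _ _ => by positivity]
    refine ENNReal.ofReal_le_ofReal ?_
    set q := ‖absCoeff U (2 * n + r)‖ with hq
    have h2 : ∀ k, ‖∑ j, coeff U (2 * n + r) k j / (q : ℂ) * coeff X (-(n + r : ℤ)) j e‖ ^ 2 ≤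
        (∑ j, (‖coeff U (2 * n + r) k j‖ / q) ^ 2) * ∑ j, ‖coeff X (-(n + r : ℤ)) j e‖ ^ 2 := by
      intro k
      refine le_trans ?_ (Finset.sum_mul_sq_le_sq_mul_sq _ _ _)
      refine pow_le_pow_left₀ (norm_nonneg _) ((norm_sum_le _ _).trans (le_of_eq ?_)) 2
      refine Finset.sum_congr rfl fun j _ => ?_
      rw [norm_mul, norm_div, Complex.norm_real, Real.norm_of_nonneg (norm_nonneg _)]
    refine (Finset.sum_le_sum fun k _ => h2 k).trans ?_
    rw [← Finset.sum_mul]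
    refine mul_le_of_le_one_left (by positivity) ?_
    simp only [div_pow]
    simp only [← Finset.sum_div]
    rw [← norm_absCoeff_sq]
    exact div_self_le_one _
  refine (ENNReal.tsum_le_tsum h1).trans ?_
  rw [enorm_sq_eq_tsum_coeff, Fintype.sum_prod_type,
    Summable.tsum_finsetSum fun _ _ => ENNReal.summable]
  refine Finset.sum_le_sum fun j _ => ?_
  refine le_trans ?_ (Finset.single_le_sum
    (f := fun e' : Fin d => ∑' n, ‖coeff X n j e'‖ₑ ^ 2) (fun _ _ => zero_le) (Finset.mem_univ e))
  exact ENNReal.tsum_comp_le_tsum_of_injective (f := fun n : ℕ => (-(n + r : ℤ)))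
    (fun a b h => by simpa using h) (fun n => ‖coeff X n j e‖ₑ ^ 2)

/-- Testing `L_U` against `testFamily` extracts the Hilbert–Schmidt norms of the coefficients of
the same parity. -/
theorem tsum_absCoeff_parity_le (hd : 0 < d) (hs : 1 < s) (U : SobolevPlus s M N) (r : ℕ) :
    ∑' n : ℕ, ‖absCoeff U.toL2 (2 * n + r)‖ₑ ≤ traceNorm (hankel d U.symbol) := by
  set e : Fin d := ⟨0, hd⟩
  have hb : IsBessel fun i : ℕ × Fin M => (modePlus (i.1, (i.2, e)) : L2plus M d) :=
    isBessel_of_orthonormal (orthonormal_modePlus.comp (fun i : ℕ × Fin M => (i.1, (i.2, e)))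
      fun i i' h => by simpa [Prod.ext_iff] using h)
  refine le_trans (le_of_eq ?_)
    (le_traceNorm (hankel d U.symbol) hb (isBessel_testFamily U.toL2 r e))
  rw [ENNReal.tsum_prod (f := fun (n : ℕ) (k : Fin M) =>
    ‖⟪testFamily U.toL2 r e (n, k), hankel d U.symbol (modePlus (n, (k, e)))⟫_ℂ‖ₑ)]
  refine tsum_congr fun n => ?_
  rw [tsum_fintype]
  set q := ‖absCoeff U.toL2 (2 * n + r)‖ with hq
  have h1 : ∀ k, ⟪testFamily U.toL2 r e (n, k), hankel d U.symbol (modePlus (n, (k, e)))⟫_ℂ =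
      (((∑ j, ‖coeff U.toL2 (2 * n + r) k j‖ ^ 2) / q : ℝ) : ℂ) := by
    intro k
    rw [inner_testFamily]
    push_cast
    rw [Finset.sum_div]
    refine Finset.sum_congr rfl fun j _ => ?_
    have h2 : (n : ℤ) - -((n : ℤ) + r) = 2 * n + r := by ring
    rw [coeff_hankel_modePlus _ _ _ (by omega), if_pos rfl, U.fourierCoeff_symbol hs, h2,
      div_mul_eq_mul_div, RCLike.star_def, Complex.mul_conj, Complex.normSq_eq_norm_sq]
    push_cast
    rfl
  simp only [h1]
  simp only [← ofReal_norm, Complex.norm_real]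
  rw [← ENNReal.ofReal_sum_of_nonneg fun _ _ => norm_nonneg _]
  congr 1
  rw [Finset.sum_congr rfl fun k _ => Real.norm_of_nonneg (by positivity), ← Finset.sum_div,
    ← norm_absCoeff_sq, ← hq, sq, mul_self_div_self]

theorem tsum_absCoeff_le (hd : 0 < d) (hs : 1 < s) (U : SobolevPlus s M N) :
    ∑' n : ℤ, ‖absCoeff U.toL2 n‖ₑ ≤ 2 * traceNorm (hankel d U.symbol) := by
  have h1 : ∑' n : ℤ, ‖absCoeff U.toL2 n‖ₑ = ∑' n : ℕ, ‖absCoeff U.toL2 (n : ℤ)‖ₑ := by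
    refine (Function.Injective.tsum_eq (g := fun n : ℕ => (n : ℤ)) Nat.cast_injective ?_).symm
    intro n hn
    rw [Function.mem_support] at hn
    by_contra h
    apply hn
    have hn0 : n < 0 := by
      by_contra h0
      exact h ⟨n.toNat, Int.toNat_of_nonneg (not_lt.mp h0)⟩
    have h2 : ‖absCoeff U.toL2 n‖ ^ 2 = 0 := by
      rw [norm_absCoeff_sq, U.coeff_eq_zero hn0]
      simp
    rw [← ofReal_norm, pow_eq_zero_iff two_ne_zero |>.mp h2, ENNReal.ofReal_zero]
  rw [h1, ← tsum_even_add_odd ENNReal.summable ENNReal.summable,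
    two_mul (traceNorm _)]
  refine add_le_add ?_ ?_
  · refine le_trans (le_of_eq (tsum_congr fun n => ?_)) (tsum_absCoeff_parity_le hd hs U 0)
    push_cast
    rw [add_zero]
  · refine le_trans (le_of_eq (tsum_congr fun n => ?_)) (tsum_absCoeff_parity_le hd hs U 1)
    push_cast
    rfl

theorem enorm_coeff_le_absCoeff (U : L2 M N) (n : ℤ) (k : Fin M) (j : Fin N) :
    ‖coeff U n k j‖ₑ ≤ ‖absCoeff U n‖ₑ := by
  rw [← ofReal_norm, ← ofReal_norm]
  refine ENNReal.ofReal_le_ofReal ?_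
  have h := PiLp.norm_apply_le (absCoeff U n) (k, j)
  simpa [absCoeff] using h

theorem linftyNorm_le_tsum_absCoeff (hs : 1 < s) (U : SobolevPlus s M N) :
    linftyNorm U.toL2 ≤ ∑' n : ℤ, ‖absCoeff U.toL2 n‖ₑ := by
  have hsum : ∀ p : Fin M × Fin N, Summable fun n => ‖coeff U.toL2 n p.1 p.2‖ :=
    fun p => U.summable_coeff hs p
  have hv : HasSum (absCoeff U.toL2) (WithLp.toLp 2 fun p : Fin M × Fin N =>
      ∑' n, ‖coeff U.toL2 n p.1 p.2‖) := by
    have h := Pi.hasSum.mpr fun p => (hsum p).hasSum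
    exact h.mapL (PiLp.continuousLinearEquiv 2 ℝ
      (fun _ : Fin M × Fin N => ℝ)).symm.toContinuousLinearMap
  have h1 : ∀ (k : Fin M) (j : Fin N), eLpNorm (U.toL2 (k, j) : Torus → ℂ) ⊤ haarAddCircle ≤
      ENNReal.ofReal (∑' n, ‖coeff U.toL2 n k j‖) := by
    intro k j
    have hnorm : ‖U.symbol k j‖ ≤ ∑' n, ‖coeff U.toL2 n k j‖ := by
      rw [← (U.hasSum_symbol hs k j).tsum_eq]
      have h2 : ∀ n : ℤ, ‖coeff U.toL2 n k j • (fourier n : C(Torus, ℂ))‖ =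
          ‖coeff U.toL2 n k j‖ := fun n => by rw [norm_smul, fourier_norm, mul_one]
      refine (norm_tsum_le_tsum_norm ?_).trans (le_of_eq (tsum_congr h2))
      simp only [h2]
      exact hsum (k, j)
    rw [eLpNorm_exponent_top]
    refine eLpNormEssSup_le_of_ae_bound ?_
    filter_upwards [U.eval_toL2 hs] with x hx
    have h3 : (U.toL2 (k, j) : Torus → ℂ) x = U.symbol k j x := congrFun (congrFun hx k) j
    rw [h3]
    exact ((U.symbol k j).norm_coe_le_norm x).trans hnorm
  have h2 : linftyNorm U.toL2 ≤ ‖(WithLp.toLp 2 fun p : Fin M × Fin N =>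
      ∑' n, ‖coeff U.toL2 n p.1 p.2‖ : EuclideanSpace ℝ (Fin M × Fin N))‖ₑ := by
    have h3 : ∀ a : ℝ≥0∞, (a ^ 2) ^ (1 / 2 : ℝ) = a := fun a => by
      rw [← ENNReal.rpow_natCast, ← ENNReal.rpow_mul]
      norm_num
    rw [linftyNorm, ← h3 ‖_‖ₑ]
    refine ENNReal.rpow_le_rpow ?_ (by norm_num)
    rw [← ofReal_norm, ← ENNReal.ofReal_pow (norm_nonneg _), EuclideanSpace.norm_sq_eq,
      Fintype.sum_prod_type, ENNReal.ofReal_sum_of_nonneg fun _ _ => by positivity]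
    refine Finset.sum_le_sum fun k _ => ?_
    rw [ENNReal.ofReal_sum_of_nonneg fun _ _ => by positivity]
    refine Finset.sum_le_sum fun j _ => ?_
    rw [ENNReal.ofReal_pow (norm_nonneg _)]
    refine pow_le_pow_left₀ zero_le ((h1 k j).trans (ENNReal.ofReal_le_ofReal ?_)) 2
    exact le_abs_self _
  rw [← hv.tsum_eq] at h2
  exact h2.trans enorm_tsum_le_tsum_enorm

end TraceBounds

/-! ### A tame estimate for products in Sobolev spaces -/

section Tame

variable {M N K : ℕ} {s : ℝ}

theorem ennreal_sum_sq_le {ι : Type*} [Fintype ι] (a : ι → ℝ≥0∞) :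
    (∑ i, a i) ^ 2 ≤ Fintype.card ι * ∑ i, a i ^ 2 := by
  have hroot : ∀ x : ℝ≥0∞, (x ^ (1 / 2 : ℝ)) ^ 2 = x := fun x => by
    rw [← ENNReal.rpow_natCast, ← ENNReal.rpow_mul]
    norm_num
  have h := ennreal_tsum_mul_le (fun _ : ι => 1) a (X := (Fintype.card ι : ℝ≥0∞) ^ (1 / 2 : ℝ))
    (Y := (∑ i, a i ^ 2) ^ (1 / 2 : ℝ)) (by rw [hroot, tsum_fintype]; simp)
    (by rw [hroot, tsum_fintype])
  rw [tsum_fintype] at h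
  simp only [one_mul] at h
  refine (pow_le_pow_left₀ zero_le h 2).trans ?_
  rw [mul_pow, hroot, hroot]

theorem ennreal_add_sq_le (a b : ℝ≥0∞) : (a + b) ^ 2 ≤ 2 * (a ^ 2 + b ^ 2) := by
  have h := ennreal_sum_sq_le ![a, b]
  simpa [Fin.sum_univ_two] using h

/-- Young's inequality `ℓ¹ * ℓ² ⊂ ℓ²`. -/
theorem tsum_conv_sq_le (a b : ℤ → ℝ≥0∞) :
    ∑' n, (∑' k, a k * b (n - k)) ^ 2 ≤ (∑' k, a k) ^ 2 * ∑' k, b k ^ 2 := by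
  have hroot : ∀ x : ℝ≥0∞, (x ^ (1 / 2 : ℝ)) ^ 2 = x := fun x => by
    rw [← ENNReal.rpow_natCast, ← ENNReal.rpow_mul]
    norm_num
  have h1 : ∀ n, (∑' k, a k * b (n - k)) ^ 2 ≤ (∑' k, a k) * ∑' k, a k * b (n - k) ^ 2 := by
    intro n
    have h := ennreal_tsum_mul_le (fun k => a k ^ (1 / 2 : ℝ))
      (fun k => a k ^ (1 / 2 : ℝ) * b (n - k)) (X := (∑' k, a k) ^ (1 / 2 : ℝ))
      (Y := (∑' k, a k * b (n - k) ^ 2) ^ (1 / 2 : ℝ))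
      (by simp only [hroot, le_refl]) (by simp only [mul_pow, hroot, le_refl])
    have h2 : ∀ k, a k ^ (1 / 2 : ℝ) * (a k ^ (1 / 2 : ℝ) * b (n - k)) = a k * b (n - k) := by
      intro k
      rw [← mul_assoc, ← sq, hroot]
    simp only [h2] at h
    refine (pow_le_pow_left₀ zero_le h 2).trans ?_
    rw [mul_pow, hroot, hroot]
  refine (ENNReal.tsum_le_tsum h1).trans ?_
  rw [ENNReal.tsum_mul_left, ENNReal.tsum_comm, sq, mul_assoc]
  refine mul_le_mul_right ?_ _
  rw [← ENNReal.tsum_mul_right]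
  refine ENNReal.tsum_le_tsum fun k => ?_
  rw [ENNReal.tsum_mul_left]
  exact mul_le_mul_right ((Equiv.subRight k).tsum_eq fun m : ℤ => b m ^ 2).le _

/-- The norm of the Wiener algebra. -/
noncomputable def wienerNorm (f : C(Torus, ℂ)) : ℝ≥0∞ := ∑' n, ‖fourierCoeff f n‖ₑ

/-- The square of the `H^s` norm of a scalar function. -/
noncomputable def sobolevSq (s : ℝ) (f : C(Torus, ℂ)) : ℝ≥0∞ :=
  ∑' n, (eweight s n * ‖fourierCoeff f n‖ₑ) ^ 2

theorem fourierCoeff_sum_continuousMap {ι : Type*} [Fintype ι] (f : ι → C(Torus, ℂ)) (n : ℤ) :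
    fourierCoeff ((∑ i, f i : C(Torus, ℂ)) : Torus → ℂ) n = ∑ i, fourierCoeff (f i) n := by
  simp only [← fourierCoeff_toLp, ← fourierBasis_repr, map_sum, lp.coeFn_sum, Finset.sum_apply]

theorem hasSum_fourierCoeff_mul (f g : C(Torus, ℂ)) (n : ℤ) :
    HasSum (fun k => fourierCoeff f (n - k) * fourierCoeff g k)
      (fourierCoeff ((f * g : C(Torus, ℂ)) : Torus → ℂ) n) := by
  have h := hasSum_fourierCoeff_scalarMul f (ContinuousMap.toLp (E := ℂ) 2 haarAddCircle ℂ g) n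
  simp only [fourierCoeff_toLp] at h
  have h2 : (scalarMul f (ContinuousMap.toLp (E := ℂ) 2 haarAddCircle ℂ g) : Torus → ℂ)
      =ᵐ[haarAddCircle] ((f * g : C(Torus, ℂ)) : Torus → ℂ) := by
    filter_upwards [coeFn_scalarMul f (ContinuousMap.toLp (E := ℂ) 2 haarAddCircle ℂ g),
      ContinuousMap.coeFn_toLp (E := ℂ) (p := 2) haarAddCircle (𝕜 := ℂ) g] with x h3 h4
    rw [h3, h4, ContinuousMap.mul_apply]
  rwa [fourierCoeff_congr_ae h2] at h

theorem enorm_fourierCoeff_mul_le (f g : C(Torus, ℂ)) (n : ℤ) :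
    ‖fourierCoeff ((f * g : C(Torus, ℂ)) : Torus → ℂ) n‖ₑ ≤
      ∑' k, ‖fourierCoeff f (n - k)‖ₑ * ‖fourierCoeff g k‖ₑ := by
  rw [← (hasSum_fourierCoeff_mul f g n).tsum_eq]
  exact enorm_tsum_le_tsum_enorm.trans (ENNReal.tsum_le_tsum fun k => (enorm_mul _ _).le)

theorem wienerNorm_mul_le (f g : C(Torus, ℂ)) :
    wienerNorm (f * g) ≤ wienerNorm f * wienerNorm g := by
  refine (ENNReal.tsum_le_tsum fun n => enorm_fourierCoeff_mul_le f g n).trans ?_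
  rw [ENNReal.tsum_comm, wienerNorm, wienerNorm, ← ENNReal.tsum_mul_left]
  refine ENNReal.tsum_le_tsum fun k => ?_
  rw [ENNReal.tsum_mul_right]
  exact mul_le_mul_left ((Equiv.subRight k).tsum_eq fun m : ℤ => ‖fourierCoeff f m‖ₑ).le _

theorem wienerNorm_sum_le {ι : Type*} [Fintype ι] (f : ι → C(Torus, ℂ)) :
    wienerNorm (∑ i, f i) ≤ ∑ i, wienerNorm (f i) := by
  simp only [wienerNorm]
  rw [← Summable.tsum_finsetSum fun _ _ => ENNReal.summable]
  refine ENNReal.tsum_le_tsum fun n => ?_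
  rw [fourierCoeff_sum_continuousMap]
  exact enorm_sum_le _ _

theorem eweight_neg_arg (s : ℝ) (n : ℤ) : eweight s (-n) = eweight s n := by
  simp [eweight, weight]

theorem wienerNorm_star (f : C(Torus, ℂ)) : wienerNorm (star f) = wienerNorm f := by
  simp only [wienerNorm, fourierCoeff_star, RCLike.star_def, RCLike.enorm_conj]
  exact (Equiv.neg ℤ).tsum_eq fun n : ℤ => ‖fourierCoeff f n‖ₑ

theorem sobolevSq_star (f : C(Torus, ℂ)) : sobolevSq s (star f) = sobolevSq s f := by
  simp only [sobolevSq, fourierCoeff_star, RCLike.star_def, RCLike.enorm_conj]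
  rw [← (Equiv.neg ℤ).tsum_eq fun n : ℤ => (eweight s n * ‖fourierCoeff f n‖ₑ) ^ 2]
  simp only [Equiv.neg_apply, eweight_neg_arg]

theorem sobolevSq_sum_le {ι : Type*} [Fintype ι] (f : ι → C(Torus, ℂ)) :
    sobolevSq s (∑ i, f i) ≤ Fintype.card ι * ∑ i, sobolevSq s (f i) := by
  simp only [sobolevSq]
  rw [← Summable.tsum_finsetSum fun _ _ => ENNReal.summable, ← ENNReal.tsum_mul_left]
  refine ENNReal.tsum_le_tsum fun n => ?_
  refine le_trans ?_ (ennreal_sum_sq_le _)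
  rw [← Finset.mul_sum, fourierCoeff_sum_continuousMap]
  exact pow_le_pow_left₀ zero_le (mul_le_mul_right (enorm_sum_le _ _) _) 2

theorem eweight_le_add (hs : 0 ≤ s) (n k : ℤ) :
    eweight s n ≤ ENNReal.ofReal (2 ^ s) * (eweight s (n - k) + eweight s k) := by
  rw [eweight, eweight, eweight, ← ENNReal.ofReal_add (weight_pos _ _).le (weight_pos _ _).le,
    ← ENNReal.ofReal_mul (by positivity)]
  refine ENNReal.ofReal_le_ofReal ?_
  have key : ∀ m : ℤ, (1 + (n : ℝ) ^ 2) ≤ 2 ^ 2 * (1 + (m : ℝ) ^ 2) →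
      weight s n ≤ 2 ^ s * weight s m := by
    intro m hm
    have h2 : (2 : ℝ) ^ s = (2 ^ 2) ^ (s / 2) := by
      rw [← Real.rpow_natCast, ← Real.rpow_mul (by norm_num)]
      congr 1
      push_cast
      ring
    rw [weight, weight, h2, ← Real.mul_rpow (by positivity) (by positivity)]
    exact Real.rpow_le_rpow (by positivity) hm (by positivity)
  have hp : (0 : ℝ) ≤ 2 ^ s := by positivity
  have h1 := mul_nonneg hp (weight_pos s (n - k)).le
  have h2 := mul_nonneg hp (weight_pos s k).le
  rw [mul_add]
  have hn : (n : ℝ) = ((n - k : ℤ) : ℝ) + k := by push_cast; ring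
  rcases le_total (((n - k : ℤ) : ℝ) ^ 2) ((k : ℝ) ^ 2) with h | h
  · refine (key k ?_).trans (by linarith)
    rw [hn]
    nlinarith [sq_nonneg (((n - k : ℤ) : ℝ) - k)]
  · refine (key (n - k) ?_).trans (by linarith)
    rw [hn]
    nlinarith [sq_nonneg (((n - k : ℤ) : ℝ) - k)]

/-- The constant in the tame product estimate. -/
noncomputable def tameMulConst (s : ℝ) : ℝ≥0∞ := ENNReal.ofReal (2 ^ s) ^ 2 * 2

/-- The tame product estimate: only one factor at a time is measured in `H^s`. -/
theorem sobolevSq_mul_le (hs : 0 ≤ s) (f g : C(Torus, ℂ)) :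
    sobolevSq s (f * g) ≤ tameMulConst s *
      (wienerNorm g ^ 2 * sobolevSq s f + wienerNorm f ^ 2 * sobolevSq s g) := by
  set a : ℤ → ℝ≥0∞ := fun k => ‖fourierCoeff f k‖ₑ with ha
  set b : ℤ → ℝ≥0∞ := fun k => ‖fourierCoeff g k‖ₑ with hb
  have h1 : ∀ n, (eweight s n * ‖fourierCoeff ((f * g : C(Torus, ℂ)) : Torus → ℂ) n‖ₑ) ^ 2 ≤
      tameMulConst s * ((∑' k, b k * (eweight s (n - k) * a (n - k))) ^ 2 +
        (∑' k, a k * (eweight s (n - k) * b (n - k))) ^ 2) := by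
    intro n
    rw [tameMulConst, mul_assoc]
    refine le_trans ?_ (mul_le_mul_right (ennreal_add_sq_le _ _) _)
    rw [← mul_pow]
    refine pow_le_pow_left₀ zero_le ?_ 2
    refine (mul_le_mul_right (enorm_fourierCoeff_mul_le f g n) _).trans ?_
    have h2 : ∑' k, a k * (eweight s (n - k) * b (n - k)) =
        ∑' k, a (n - k) * (eweight s k * b k) := by
      rw [← (Equiv.subLeft n).tsum_eq]
      simp only [Equiv.subLeft_apply, sub_sub_cancel]
    rw [h2, ← ENNReal.tsum_add, ← ENNReal.tsum_mul_left, ← ENNReal.tsum_mul_left]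
    refine ENNReal.tsum_le_tsum fun k => ?_
    refine (mul_le_mul_left (eweight_le_add hs n k) _).trans (le_of_eq ?_)
    simp only [ha, hb]
    ring
  refine (ENNReal.tsum_le_tsum h1).trans ?_
  rw [ENNReal.tsum_mul_left, ENNReal.tsum_add]
  exact mul_le_mul_right (add_le_add (tsum_conv_sq_le b fun k => eweight s k * a k)
    (tsum_conv_sq_le a fun k => eweight s k * b k)) _

theorem wienerNorm_matrix_mul_le {a : Matrix (Fin M) (Fin N) C(Torus, ℂ)}
    {b : Matrix (Fin N) (Fin K) C(Torus, ℂ)} {wa wb : ℝ≥0∞}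
    (ha : ∀ k j, wienerNorm (a k j) ≤ wa) (hb : ∀ k j, wienerNorm (b k j) ≤ wb) (k : Fin M)
    (j : Fin K) : wienerNorm ((a * b) k j) ≤ N * (wa * wb) := by
  rw [Matrix.mul_apply]
  refine (wienerNorm_sum_le _).trans ((Finset.sum_le_sum fun l _ =>
    (wienerNorm_mul_le _ _).trans (mul_le_mul' (ha k l) (hb l j))).trans ?_)
  rw [Finset.sum_const, Finset.card_univ, Fintype.card_fin, nsmul_eq_mul]

theorem sobolevSq_matrix_mul_le (hs : 0 ≤ s) {a : Matrix (Fin M) (Fin N) C(Torus, ℂ)}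
    {b : Matrix (Fin N) (Fin K) C(Torus, ℂ)} {wa wb sa sb : ℝ≥0∞}
    (ha : ∀ k j, wienerNorm (a k j) ≤ wa) (hb : ∀ k j, wienerNorm (b k j) ≤ wb)
    (ha' : ∀ k j, sobolevSq s (a k j) ≤ sa) (hb' : ∀ k j, sobolevSq s (b k j) ≤ sb) (k : Fin M)
    (j : Fin K) : sobolevSq s ((a * b) k j) ≤
      N * (N * (tameMulConst s * (wb ^ 2 * sa + wa ^ 2 * sb))) := by
  rw [Matrix.mul_apply]
  refine (sobolevSq_sum_le _).trans ?_
  rw [Fintype.card_fin]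
  refine mul_le_mul_right ((Finset.sum_le_sum fun l _ => (sobolevSq_mul_le hs _ _).trans
    (mul_le_mul_right (add_le_add (mul_le_mul' (pow_le_pow_left₀ zero_le (hb l j) 2) (ha' k l))
      (mul_le_mul' (pow_le_pow_left₀ zero_le (ha k l) 2) (hb' l j))) _)).trans ?_) _
  rw [Finset.sum_const, Finset.card_univ, Fintype.card_fin, nsmul_eq_mul]

/-- The square of the constant in the tame estimate for `Π_{≥ 0}(U U^* U)`. -/
noncomputable def tameCubicConst (s : ℝ) (M N : ℕ) : ℝ≥0∞ :=
  (M * N : ℕ) * (M * (M * (tameMulConst s *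
    (N * (N * (tameMulConst s * 2)) + (N : ℝ≥0∞) ^ 2))))

theorem tameCubicConst_ne_top : tameCubicConst s M N ≠ ⊤ := by
  have h : tameMulConst s ≠ ⊤ := by
    rw [tameMulConst]
    finiteness
  rw [tameCubicConst]
  finiteness

/-- The tame estimate for the cubic nonlinearity: `‖Π_{≥ 0}(U U^* U)‖_{H^s} ≤ C w² ‖U‖_{H^s}`,
where `w` bounds the Wiener norms of the entries of `U`. -/
theorem SobolevPlus.enorm_le_of_cubic (hs : 1 < s) {U V : SobolevPlus s M N} {w : ℝ≥0∞}
    (hw : ∀ k j, wienerNorm (U.symbol k j) ≤ w)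
    (hV : ∀ n k j, ‖coeff V.toL2 n k j‖ₑ ≤
      ‖fourierCoeff ((U.symbol * U.symbolᴴ * U.symbol) k j) n‖ₑ) :
    ‖V‖ₑ ≤ tameCubicConst s M N ^ (1 / 2 : ℝ) * w ^ 2 * ‖U‖ₑ := by
  have hs0 : 0 ≤ s := by linarith
  have hU : ∀ k j, sobolevSq s (U.symbol k j) ≤ ‖U‖ₑ ^ 2 := by
    intro k j
    simp only [sobolevSq, U.fourierCoeff_symbol hs]
    exact U.tsum_sq_le (k, j)
  have hw' : ∀ k j, wienerNorm (U.symbolᴴ k j) ≤ w := fun k j => by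
    rw [Matrix.conjTranspose_apply, wienerNorm_star]
    exact hw j k
  have hU' : ∀ k j, sobolevSq s (U.symbolᴴ k j) ≤ ‖U‖ₑ ^ 2 := fun k j => by
    rw [Matrix.conjTranspose_apply, sobolevSq_star]
    exact hU j k
  have h1 := fun k j => sobolevSq_matrix_mul_le hs0 (wienerNorm_matrix_mul_le hw hw') hw
    (sobolevSq_matrix_mul_le hs0 hw hw' hU hU') hU k j
  have hroot : (tameCubicConst s M N ^ (1 / 2 : ℝ)) ^ 2 = tameCubicConst s M N := by
    rw [← ENNReal.rpow_natCast, ← ENNReal.rpow_mul]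
    norm_num
  refine (ENNReal.pow_le_pow_left_iff two_ne_zero).mp ?_
  rw [V.enorm_sq_eq, mul_pow, mul_pow, hroot]
  have h2 : ∀ p : Fin M × Fin N, ∑' n, (eweight s n * ‖coeff V.toL2 n p.1 p.2‖ₑ) ^ 2 ≤
      sobolevSq s ((U.symbol * U.symbolᴴ * U.symbol) p.1 p.2) := fun p =>
    ENNReal.tsum_le_tsum fun n => pow_le_pow_left₀ zero_le (mul_le_mul_right (hV n p.1 p.2) _) 2
  refine (Finset.sum_le_sum fun p _ => (h2 p).trans (h1 p.1 p.2)).trans (le_of_eq ?_)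
  rw [Finset.sum_const, Finset.card_univ, Fintype.card_prod, Fintype.card_fin, Fintype.card_fin,
    nsmul_eq_mul, tameCubicConst]
  ring

end Tame

/-! ### Solutions of the matrix Szegő equation -/

section Solution

variable {M N d : ℕ} {s : ℝ} {U : ℝ → SobolevPlus s M N}

theorem IsSmoothSolution.hasDerivAt (hU : IsSmoothSolution U) (t : ℝ) :
    HasDerivAt U (deriv U t) t :=
  (hU.contDiff.differentiable (by simp) t).hasDerivAt

theorem IsSmoothSolution.equation_symbol (hs : 1 < s) (hU : IsSmoothSolution U) (t : ℝ) :
    (Complex.I • deriv U t).toL2 =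
      (szego (contL2 ((U t).symbol * (U t).symbolᴴ * (U t).symbol)) : L2 M N) := by
  rw [map_smul, hU.equation t]
  congr 2
  apply ofFun_eq
  filter_upwards [(U t).eval_toL2 hs,
    eval_contL2 ((U t).symbol * (U t).symbolᴴ * (U t).symbol)] with x h1 h2
  rw [h1, h2]
  ext k j
  simp [Matrix.mul_apply, Matrix.conjTranspose_apply]

/-- `L_u` only depends on the nonnegative frequencies of `u`, so the projection `Π_{≥ 0}` in the
equation can be dropped. -/
theorem IsSmoothSolution.hankel_deriv (hs : 1 < s) (hU : IsSmoothSolution U) (t : ℝ) :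
    hankel d (Complex.I • (deriv U t).symbol) =
      hankel d ((U t).symbol * (U t).symbolᴴ * (U t).symbol) := by
  set c := (U t).symbol * (U t).symbolᴴ * (U t).symbol with hc
  have h : hankel d (Complex.I • (deriv U t).symbol + (-1 : ℂ) • c) = 0 := by
    apply hankel_eq_zero
    intro n hn k j
    rw [← SobolevPlus.symbol_smul hs, ← coeff_contL2]
    have h1 : contL2 ((Complex.I • deriv U t).symbol + (-1 : ℂ) • c) =
        (Complex.I • deriv U t).toL2 + (-1 : ℂ) • contL2 c := by
      rw [← SobolevPlus.contL2_symbol hs]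
      ext1 p
      simp only [contL2, Matrix.add_apply, Matrix.smul_apply, map_add, map_smul, PiLp.add_apply,
        PiLp.smul_apply]
    rw [h1, hU.equation_symbol hs, coeff_add, coeff_smul, coeff_szego, if_pos hn, ← hc,
      neg_one_smul, add_neg_cancel, Matrix.zero_apply]
  have h2 : star (-1 : ℂ) = -1 := by simp
  rw [hankel_add, hankel_smul (-1 : ℂ) c, h2] at h
  rw [← sub_eq_zero, ← h]
  module

theorem IsSmoothSolution.isLaxPath (hs : 1 < s) (hU : IsSmoothSolution U) :
    IsLaxPath fun t => hankel d (U t).symbol := by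
  intro t
  obtain ⟨A, D, hA, hD, hAD⟩ := exists_hankel_lax (u := (U t).symbol)
    (fun n hn k j => by
      rw [(U t).fourierCoeff_symbol hs, (U t).coeff_eq_zero hn, Matrix.zero_apply])
    (hU.hankel_deriv (d := d) hs t)
  refine ⟨A, D, hA, hD, fun ε hε => ?_⟩
  set C := (hankelConst s M N d).toReal with hC
  have hC0 : 0 ≤ C := ENNReal.toReal_nonneg
  have hCe : hankelConst s M N d = ENNReal.ofReal C :=
    (ENNReal.ofReal_toReal (hankelConst_ne_top hs)).symm
  have hd := hasDerivAt_iff_isLittleO_nhds_zero.mp (hU.hasDerivAt t)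
  have hd2 := hd.def (show 0 < ε / (C + 1) by positivity)
  obtain ⟨δ, hδ, hδ'⟩ := Metric.eventually_nhds_iff.mp hd2
  refine ⟨δ, hδ, fun h hh => ?_⟩
  have h1 := hδ' (y := h) (by rwa [Real.dist_0_eq_abs])
  have h2 : hankel d (U (t + h)).symbol - hankel d (U t).symbol -
      (h : ℂ) • hankel d (deriv U t).symbol =
        hankel d (U (t + h) - U t - h • deriv U t).symbol := by
    have h3 : U (t + h) - U t - h • deriv U t =
        U (t + h) + (-1 : ℂ) • U t + (-h : ℂ) • deriv U t := by
      rw [neg_one_smul, neg_smul, ← Complex.coe_smul]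
      abel
    have h4 : star (-1 : ℂ) = -1 := by simp
    have h5 : star (-h : ℂ) = -h := by simp
    rw [h3, SobolevPlus.symbol_add hs, SobolevPlus.symbol_add hs, SobolevPlus.symbol_smul hs,
      SobolevPlus.symbol_smul hs, hankel_add, hankel_add, hankel_smul, hankel_smul, h4, h5]
    module
  rw [← hAD, h2]
  refine (traceNorm_hankel_le hs _).trans ?_
  rw [hCe, ← ofReal_norm, ← ENNReal.ofReal_mul hC0]
  refine ENNReal.ofReal_le_ofReal ((mul_le_mul_of_nonneg_left h1 hC0).trans ?_)
  rw [Real.norm_eq_abs, ← mul_assoc]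
  refine mul_le_mul_of_nonneg_right ?_ (abs_nonneg h)
  rw [mul_div_assoc', div_le_iff₀ (by positivity)]
  nlinarith

theorem traceNorm_hankel_ne_top (hs : 1 < s) (U : SobolevPlus s M N) :
    traceNorm (hankel d U.symbol) ≠ ⊤ :=
  ((traceNorm_hankel_le hs U).trans_lt
    (ENNReal.mul_lt_top (hankelConst_ne_top hs).lt_top enorm_lt_top)).ne

theorem IsSmoothSolution.traceNorm_eq (hs : 1 < s) (hU : IsSmoothSolution U) (t t' : ℝ) :
    traceNorm (hankel d (U t).symbol) = traceNorm (hankel d (U t').symbol) :=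
  (hU.isLaxPath hs).traceNorm_eq (fun t => traceNorm_hankel_ne_top hs (U t)) t t'

theorem toReal_traceNorm_hankel_le (hs : 1 < s) (U : SobolevPlus s M N) :
    (traceNorm (hankel d U.symbol)).toReal ≤ (hankelConst s M N d).toReal * ‖U‖ := by
  have h := ENNReal.toReal_mono (ENNReal.mul_ne_top (hankelConst_ne_top hs) enorm_ne_top)
    (traceNorm_hankel_le (d := d) hs U)
  rwa [ENNReal.toReal_mul, toReal_enorm] at h

/-- Along a solution `‖U'‖_{H^s} ≤ C (2 Tr |L_{U(0)}|)² ‖U‖_{H^s}`. -/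
theorem IsSmoothSolution.enorm_deriv_le (hd : 0 < d) (hs : 1 < s) (hU : IsSmoothSolution U)
    (t : ℝ) : ‖deriv U t‖ₑ ≤ tameCubicConst s M N ^ (1 / 2 : ℝ) *
      (2 * traceNorm (hankel d (U 0).symbol)) ^ 2 * ‖U t‖ₑ := by
  refine SobolevPlus.enorm_le_of_cubic hs (fun k j => ?_) fun n k j => ?_
  · rw [hU.traceNorm_eq hs 0 t]
    refine le_trans (ENNReal.tsum_le_tsum fun n => ?_) (tsum_absCoeff_le hd hs (U t))
    rw [(U t).fourierCoeff_symbol hs]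
    exact enorm_coeff_le_absCoeff _ n k j
  · have h : ‖coeff (deriv U t).toL2 n k j‖ₑ =
        ‖coeff (Complex.I • deriv U t).toL2 n k j‖ₑ := by
      rw [map_smul, coeff_smul, Matrix.smul_apply, smul_eq_mul, enorm_mul, ← ofReal_norm Complex.I,
        Complex.norm_I, ENNReal.ofReal_one, one_mul]
    rw [h, hU.equation_symbol hs, coeff_szego]
    split_ifs
    · rw [coeff_contL2]
    · rw [Matrix.zero_apply, enorm_zero]
      exact zero_le

/-- Gronwall's inequality in both directions of time. -/
theorem norm_le_exp_of_norm_deriv_le {E : Type*} [NormedAddCommGroup E] [NormedSpace ℝ E]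
    {f : ℝ → E} {f' : ℝ → E} {K : ℝ} (hf : ∀ t, HasDerivAt f (f' t) t)
    (hK : ∀ t, ‖f' t‖ ≤ K * ‖f t‖) (t : ℝ) : ‖f t‖ ≤ ‖f 0‖ * Real.exp (K * |t|) := by
  have key : ∀ {g g' : ℝ → E}, (∀ t, HasDerivAt g (g' t) t) → (∀ t, ‖g' t‖ ≤ K * ‖g t‖) →
      ∀ t, 0 ≤ t → ‖g t‖ ≤ ‖g 0‖ * Real.exp (K * t) := by
    intro g g' hg hgK t ht
    have h := norm_le_gronwallBound_of_norm_deriv_right_le (f := g) (f' := g') (δ := ‖g 0‖)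
      (K := K) (ε := 0) (a := 0) (b := t)
      (fun x _ => (hg x).continuousAt.continuousWithinAt)
      (fun x _ => (hg x).hasDerivWithinAt) le_rfl
      (fun x _ => by rw [add_zero]; exact hgK x) t ⟨ht, le_rfl⟩
    rwa [gronwallBound_ε0, sub_zero] at h
  rcases le_total 0 t with ht | ht
  · rw [abs_of_nonneg ht]
    exact key hf hK t ht
  · rw [abs_of_nonpos ht]
    have hg : ∀ t, HasDerivAt (fun t => f (-t)) (-f' (-t)) t := fun t => by
      have h := (hf (-t)).scomp t (hasDerivAt_neg t)
      rwa [neg_one_smul] at h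
    have h := key hg (fun t => by rw [norm_neg]; exact hK (-t)) (-t) (neg_nonneg.mpr ht)
    simpa using h

theorem IsSmoothSolution.norm_le (hd : 0 < d) (hs : 1 < s) (hU : IsSmoothSolution U) (t : ℝ) :
    ‖U t‖ ≤ ‖U 0‖ * Real.exp ((tameCubicConst s M N ^ (1 / 2 : ℝ)).toReal *
      (2 * ((hankelConst s M N d).toReal * ‖U 0‖)) ^ 2 * |t|) := by
  refine norm_le_exp_of_norm_deriv_le hU.hasDerivAt (fun t => ?_) t
  have hfin := traceNorm_hankel_ne_top (d := d) hs (U 0)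
  have hct : tameCubicConst s M N ^ (1 / 2 : ℝ) ≠ ⊤ :=
    ENNReal.rpow_ne_top_of_nonneg (by norm_num) tameCubicConst_ne_top
  have h := ENNReal.toReal_mono (ENNReal.mul_ne_top (ENNReal.mul_ne_top hct
    (ENNReal.pow_ne_top (ENNReal.mul_ne_top ENNReal.ofNat_ne_top hfin))) enorm_ne_top)
    (hU.enorm_deriv_le hd hs t)
  rw [ENNReal.toReal_mul, ENNReal.toReal_mul, ENNReal.toReal_pow, ENNReal.toReal_mul, toReal_enorm,
    toReal_enorm, ENNReal.toReal_ofNat] at h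
  refine h.trans ?_
  have h2 := toReal_traceNorm_hankel_le (d := d) hs (U 0)
  have h3 : 0 ≤ (traceNorm (hankel d (U 0).symbol)).toReal := ENNReal.toReal_nonneg
  gcongr

end Solution

end MatrixSzego

theorem mainTheorem4 (M N d : ℕ) (hM : 0 < M) (hN : 0 < N) (hd : 0 < d) (s : ℝ) (hs : 1 < s) :
    ∃ C : ℝ, 0 < C ∧ ∀ U : ℝ → SobolevPlus s M N, IsSmoothSolution U →
      (∃ (B : L2plus M d →L[ℂ] L2plus M d) (τ : ℝ),
        IsPositiveSqrt B (fun G => hankelR d (U 0).toL2 (hankelL d (U 0).toL2 G)) ∧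
        HasTrace B τ ∧
        (⨆ t : ℝ, linftyNorm (U t).toL2) ≤ ENNReal.ofReal (2 * τ) ∧
        ∀ t : ℝ, 2 * τ ≤ C * ‖U t‖) ∧
      ∀ t : ℝ, ‖U t‖ ≤ C * Real.exp (C * |t| * ‖U 0‖ ^ 2) * ‖U 0‖ := by
  set c₁ := (hankelConst s M N d).toReal with hc₁
  set c₂ := (tameCubicConst s M N ^ (1 / 2 : ℝ)).toReal with hc₂
  have hc₁0 : 0 ≤ c₁ := ENNReal.toReal_nonneg
  have hc₂0 : 0 ≤ c₂ := ENNReal.toReal_nonneg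
  set C := 1 + 2 * c₁ + c₂ * (2 * c₁) ^ 2 with hC
  have hC1 : 1 ≤ C := by
    have : 0 ≤ c₂ * (2 * c₁) ^ 2 := by positivity
    linarith
  have hC2 : 2 * c₁ ≤ C := by
    have : 0 ≤ c₂ * (2 * c₁) ^ 2 := by positivity
    linarith
  have hC3 : c₂ * (2 * c₁) ^ 2 ≤ C := by linarith
  refine ⟨C, by linarith, fun U hU => ⟨?_, fun t => ?_⟩⟩
  · have hfin := traceNorm_hankel_ne_top (d := d) hs (U 0)
    obtain ⟨B, hB, hBτ⟩ := exists_sqrt_hasTrace (hankel d (U 0).symbol) hfin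
    refine ⟨B, (traceNorm (hankel d (U 0).symbol)).toReal, ?_, hBτ, ?_, fun t => ?_⟩
    · simp only [(U 0).hankelR_hankelL_eq hs]
      exact hB
    · refine iSup_le fun t => ?_
      refine ((linftyNorm_le_tsum_absCoeff hs (U t)).trans (tsum_absCoeff_le hd hs (U t))).trans ?_
      rw [hU.traceNorm_eq hs t 0, ENNReal.ofReal_mul zero_le_two, ENNReal.ofReal_toReal hfin,
        ENNReal.ofReal_ofNat]
    · rw [hU.traceNorm_eq hs 0 t]
      have h := toReal_traceNorm_hankel_le (d := d) hs (U t)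
      have h2 := mul_le_mul_of_nonneg_right hC2 (norm_nonneg (U t))
      linarith
  · have h1 : c₂ * (2 * (c₁ * ‖U 0‖)) ^ 2 * |t| ≤ C * |t| * ‖U 0‖ ^ 2 := by
      have h2 := mul_le_mul_of_nonneg_right hC3
        (show 0 ≤ |t| * ‖U 0‖ ^ 2 by positivity)
      linarith
    calc ‖U t‖ ≤ ‖U 0‖ * Real.exp (c₂ * (2 * (c₁ * ‖U 0‖)) ^ 2 * |t|) := hU.norm_le hd hs t
      _ ≤ ‖U 0‖ * Real.exp (C * |t| * ‖U 0‖ ^ 2) := by gcongr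
      _ ≤ C * (‖U 0‖ * Real.exp (C * |t| * ‖U 0‖ ^ 2)) :=
          le_mul_of_one_le_left (by positivity) hC1
      _ = C * Real.exp (C * |t| * ‖U 0‖ ^ 2) * ‖U 0‖ := by ring
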